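/- For a real matrix $M$ let $\|M\|_F$ be its Frobenius norm and $M^\dagger$ its Moore–Penrose pseudoinverse. For $A\in\mathbb{R}^{k\times n}$ and $B\in\mathbb{R}^{d\times n}$ consider the rank-constrained regression $$\mathrm{OPT}(A,B):=\min_{X\in\mathbb{R}^{d\times k},\ \mathrm{rank}(X)\le k}\|XA-B\|_F^2 .$$ For $k\ge 1$, the ridge leverage score of the $l$-th column $b_l$ of $B$ is $\bar\tau_l(B)=b_l^\top(BB^\top+\lambda I)^\dagger b_l$, where $\lambda=\|B-B_k\|_F^2/k$ and $B_k$ is a best approximation of $B$ of rank at most $k$. For a probability vector $p$ on $[n]$ and i.i.d. indices $I_1,\dots,I_r$ with law $p$, the sampling matrix $S\in\mathbb{R}^{r\times n}$ has $j$-th row $e_{I_j}^\top/\sqrt{r\,p_{I_j}}$. It is a ridge leverage score sampling matrix of $B$ if $p$ is proportional to $(\bar\tau_l(B))_{l\in[n]}$ (for $B=0$, where all scores vanish, any $p$ is allowed). **(Approximation.)** There is an absolute constant $C>0$ such that for all $k\ge1$, all $d,n$, all $A\in\mathbb{R}^{k\times n}$, $B\in\mathbb{R}^{d\times n}$, all $\epsilon,\delta\in(0,1)$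 and all integers $r\ge C\,k\log(2k/\delta)/\epsilon^2$: the minimum $\mathrm{OPT}(A,B)$ is attained, and if $S\in\mathbb{R}^{r\times n}$ is a ridge leverage score sampling matrix of $B$, then with probability at least $1-\delta$ there is a matrix $X'\in\mathbb{R}^{d\times k}$ with $\mathrm{rank}(X')\le k$, all of whose columns lie in the column span of $BS^\top$, such that $$\|X'A-B\|_F^2\le(2+\epsilon)\,\mathrm{OPT}(A,B).$$ **(The factor $2$ when the regression sampled according to $B$ is solved.)** Let $k=d=1$, $n\ge1$, $B=e_{n+1}^\top\in\mathbb{R}^{1\times(n+1)}$ and $A_i=(e_i+e_{n+1})^\top\in\mathbb{R}^{1\times(n+1)}$ for $i\in[n]$. Then $\mathrm{OPT}(A_i,B)=\tfrac12$, attained exactly at $x=\tfrac12$, while $x'=1$ has cost $\|x'A_i-B\|_2^2=1=2\,\mathrm{OPT}(A_i,B)$. * For every $i\in[n]$ and $r\ge1$, if $S$ is a ridge leverage score sampling matrix of $B$ with $r$ rows, then almost surely the unique minimizer of the sampled regression $\min_{x\in\mathbb{R}}\|xA_iS^\top-BS^\top\|_2^2$ is $x'=1$. * For every $r\ge0$ and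 every probability vector $p$ on $[n+1]$, if $i$ is uniform on $[n]$ and $S$ is the sampling matrix of $r$ i.i.d. indices with law $p$, independent of $i$, then with probability at least $1-(1-p_{n+1})^r-r(1-p_{n+1})/n$ the unique minimizer of the sampled regression is $x'=1$. -/

import Mathlib

open MeasureTheory ProbabilityTheory Matrix

-- The norm of a matrix is the Frobenius norm throughout.
attribute [local instance] Matrix.frobeniusNormedAddCommGroup

namespace RidgeSampling

noncomputable section

/-- The Moore–Penrose pseudoinverse of a real symmetric matrix, obtained by inverting its nonzero
eigenvalues; the lemmas below are the four Penrose equations. -/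
def pinv {d : ℕ} {M : Matrix (Fin d) (Fin d) ℝ} (hM : M.IsHermitian) :
    Matrix (Fin d) (Fin d) ℝ :=
  (hM.eigenvectorUnitary : Matrix (Fin d) (Fin d) ℝ) *
    Matrix.diagonal (fun i => (hM.eigenvalues i)⁻¹) *
    star (hM.eigenvectorUnitary : Matrix (Fin d) (Fin d) ℝ)

section Penrose

variable {d : ℕ} {M : Matrix (Fin d) (Fin d) ℝ}

theorem spectral_eq (hM : M.IsHermitian) :
    M = (hM.eigenvectorUnitary : Matrix (Fin d) (Fin d) ℝ) * Matrix.diagonal hM.eigenvalues *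
      star (hM.eigenvectorUnitary : Matrix (Fin d) (Fin d) ℝ) := by
  have h := hM.spectral_theorem
  rw [Unitary.conjStarAlgAut_apply] at h
  exact h

theorem conj_mul_conj (hM : M.IsHermitian) (a b : Fin d → ℝ) :
    ((hM.eigenvectorUnitary : Matrix (Fin d) (Fin d) ℝ) * Matrix.diagonal a *
      star (hM.eigenvectorUnitary : Matrix (Fin d) (Fin d) ℝ)) *
    ((hM.eigenvectorUnitary : Matrix (Fin d) (Fin d) ℝ) * Matrix.diagonal b *
      star (hM.eigenvectorUnitary : Matrix (Fin d) (Fin d) ℝ)) =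
    (hM.eigenvectorUnitary : Matrix (Fin d) (Fin d) ℝ) * Matrix.diagonal (fun i => a i * b i) *
      star (hM.eigenvectorUnitary : Matrix (Fin d) (Fin d) ℝ) := by
  have h : star (hM.eigenvectorUnitary : Matrix (Fin d) (Fin d) ℝ) *
      (hM.eigenvectorUnitary : Matrix (Fin d) (Fin d) ℝ) = 1 :=
    Unitary.coe_star_mul_self _
  rw [← Matrix.diagonal_mul_diagonal]
  simp only [Matrix.mul_assoc]
  rw [← Matrix.mul_assoc (star _) _ (Matrix.diagonal b * _), h, Matrix.one_mul]

theorem transpose_conj (hM : M.IsHermitian) (a : Fin d → ℝ) :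
    ((hM.eigenvectorUnitary : Matrix (Fin d) (Fin d) ℝ) * Matrix.diagonal a *
      star (hM.eigenvectorUnitary : Matrix (Fin d) (Fin d) ℝ))ᵀ =
    (hM.eigenvectorUnitary : Matrix (Fin d) (Fin d) ℝ) * Matrix.diagonal a *
      star (hM.eigenvectorUnitary : Matrix (Fin d) (Fin d) ℝ) := by
  simp only [Matrix.star_eq_conjTranspose, Matrix.conjTranspose_eq_transpose_of_trivial,
    Matrix.transpose_mul, Matrix.transpose_transpose, Matrix.diagonal_transpose, Matrix.mul_assoc]

theorem mul_pinv_eq (hM : M.IsHermitian) :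
    M * pinv hM = (hM.eigenvectorUnitary : Matrix (Fin d) (Fin d) ℝ) *
      Matrix.diagonal (fun i => hM.eigenvalues i * (hM.eigenvalues i)⁻¹) *
      star (hM.eigenvectorUnitary : Matrix (Fin d) (Fin d) ℝ) :=
  (congrArg (fun N => N * pinv hM) (spectral_eq hM)).trans (conj_mul_conj hM _ _)

theorem pinv_mul_eq (hM : M.IsHermitian) :
    pinv hM * M = (hM.eigenvectorUnitary : Matrix (Fin d) (Fin d) ℝ) *
      Matrix.diagonal (fun i => (hM.eigenvalues i)⁻¹ * hM.eigenvalues i) *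
      star (hM.eigenvectorUnitary : Matrix (Fin d) (Fin d) ℝ) :=
  (congrArg (fun N => pinv hM * N) (spectral_eq hM)).trans (conj_mul_conj hM _ _)

theorem mul_pinv_mul (hM : M.IsHermitian) : M * pinv hM * M = M := by
  rw [mul_pinv_eq]
  refine (congrArg (fun N => _ * N) (spectral_eq hM)).trans ?_
  refine Eq.trans ?_ (spectral_eq hM).symm
  rw [conj_mul_conj]
  congr 3
  funext i
  exact mul_inv_mul_cancel _

theorem pinv_mul_pinv (hM : M.IsHermitian) : pinv hM * M * pinv hM = pinv hM := by
  rw [pinv_mul_eq, pinv, conj_mul_conj]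
  congr 3
  funext i
  by_cases h : hM.eigenvalues i = 0 <;> simp [h]

theorem mul_pinv_transpose (hM : M.IsHermitian) : (M * pinv hM)ᵀ = M * pinv hM := by
  rw [mul_pinv_eq, transpose_conj]

theorem pinv_mul_transpose (hM : M.IsHermitian) : (pinv hM * M)ᵀ = pinv hM * M := by
  rw [pinv_mul_eq, transpose_conj]

end Penrose

/-- `‖B - B_k‖_F² / k`, where `B_k` is a best approximation of `B` of rank at most `k`. -/
def ridgeParam {d n : ℕ} (B : Matrix (Fin d) (Fin n) ℝ) (k : ℕ) : ℝ :=
  sInf {c : ℝ | ∃ C : Matrix (Fin d) (Fin n) ℝ, C.rank ≤ k ∧ c = ‖B - C‖ ^ 2} / k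

/-- `B Bᵀ + λ I` with `λ = ‖B - B_k‖_F² / k`. -/
def ridgeGram {d n : ℕ} (B : Matrix (Fin d) (Fin n) ℝ) (k : ℕ) : Matrix (Fin d) (Fin d) ℝ :=
  B * Bᵀ + ridgeParam B k • (1 : Matrix (Fin d) (Fin d) ℝ)

theorem ridgeGram_isHermitian {d n : ℕ} (B : Matrix (Fin d) (Fin n) ℝ) (k : ℕ) :
    (ridgeGram B k).IsHermitian := by
  simp [ridgeGram, Matrix.IsHermitian, Matrix.conjTranspose_eq_transpose_of_trivial,
    Matrix.transpose_mul]

/-- The rank-`k` ridge leverage score `b_lᵀ (B Bᵀ + λ I)† b_l` of the `l`-th column `b_l`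
of `B`. -/
def ridgeScore {d n : ℕ} (B : Matrix (Fin d) (Fin n) ℝ) (k : ℕ) (l : Fin n) : ℝ :=
  B.col l ⬝ᵥ (pinv (ridgeGram_isHermitian B k) *ᵥ B.col l)

/-- `p` is a probability vector proportional to the ridge leverage scores of the columns of `B`
(for `B = 0` all scores vanish and every probability vector qualifies). -/
def IsRidgeDistribution {d n : ℕ} (B : Matrix (Fin d) (Fin n) ℝ) (k : ℕ) (p : Fin n → ℝ) : Prop :=
  (∀ l, 0 ≤ p l) ∧ ∑ l, p l = 1 ∧ ∀ l, p l * ∑ j, ridgeScore B k j = ridgeScore B k l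

/-- `I 0, …, I (r - 1)` are independent random indices with common law `p`. -/
structure IsIIDSample {Ω : Type*} [MeasurableSpace Ω] (μ : Measure Ω) {r n : ℕ}
    (p : Fin n → ℝ) (I : Fin r → Ω → Fin n) : Prop where
  measurable : ∀ j, Measurable (I j)
  indep : iIndepFun I μ
  law : ∀ j l, μ.real {ω | I j ω = l} = p l

/-- The sampling and rescaling matrix `S ∈ ℝ^{r × n}` of the indices `s 0, …, s (r - 1)` drawn
from `p`: the `j`-th row is `e_{s j}ᵀ / √(r p_{s j})`, so that the columns of `B Sᵀ` are rescaled
columns of `B`. -/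
def samplingMatrix {r n : ℕ} (p : Fin n → ℝ) (s : Fin r → Fin n) : Matrix (Fin r) (Fin n) ℝ :=
  Matrix.of fun j l => if s j = l then 1 / √(r * p (s j)) else 0

/-- The minimizers of the rank-constrained regression `min_{rank X ≤ k} ‖X A - B‖_F²`. -/
def solutions {d n k : ℕ} (A : Matrix (Fin k) (Fin n) ℝ) (B : Matrix (Fin d) (Fin n) ℝ) :
    Set (Matrix (Fin d) (Fin k) ℝ) :=
  {X | X.rank ≤ k ∧
    ∀ Y : Matrix (Fin d) (Fin k) ℝ, Y.rank ≤ k → ‖X * A - B‖ ^ 2 ≤ ‖Y * A - B‖ ^ 2}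

/-- The optimal cost of the rank-constrained regression `min_{rank X ≤ k} ‖X A - B‖_F²`. -/
def opt {d n k : ℕ} (A : Matrix (Fin k) (Fin n) ℝ) (B : Matrix (Fin d) (Fin n) ℝ) : ℝ :=
  sInf {c : ℝ | ∃ X : Matrix (Fin d) (Fin k) ℝ, X.rank ≤ k ∧ c = ‖X * A - B‖ ^ 2}

/-- The row vector `(e_i + e_{n+1})ᵀ ∈ ℝ^{1 × (n + 1)}`, for `i` one of the first `n` indices. -/
def hardA {n : ℕ} (i : Fin n) : Matrix (Fin 1) (Fin (n + 1)) ℝ :=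
  Matrix.of fun _ l =>
    (Pi.single i.castSucc 1 : Fin (n + 1) → ℝ) l + (Pi.single (Fin.last n) 1 : Fin (n + 1) → ℝ) l

/-- The row vector `e_{n+1}ᵀ ∈ ℝ^{1 × (n + 1)}`. -/
def hardB (n : ℕ) : Matrix (Fin 1) (Fin (n + 1)) ℝ :=
  Matrix.of fun _ l => (Pi.single (Fin.last n) 1 : Fin (n + 1) → ℝ) l

end

end RidgeSampling

/-! Let `P` be the orthogonal projection onto the row space of `A`, so that `B * P` is the optimal
fit, and let `Q` be the projection onto the span of the sampled columns. The candidate is the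
optimal solution with its columns projected by `Q`. Its residual is `-(1 - Q) * B * P + (B * P -
B)`, and the two terms are orthogonal, so the cost is OPT plus `‖(1 - Q) * B * P‖ ^ 2`. As `P` has
trace at most `k`, the second term is at most `k * λ` once `(1 - Q) * B` has squared operator norm
at most `λ`; and `k * λ = ‖B - B_k‖ ^ 2` is at most OPT, because `B * P` has rank at most `k`
(`norm_sq_proj_le`). This gives the factor `2` exactly; `ε` is slack.

No two-sided spectral approximation is needed, only that every `y` orthogonal to the sample has `‖Bᵀ
y‖² ≤ λ ‖y‖²`. In the metric of `B Bᵀ + λ I` this reads `‖Xᵀ v‖² ≤ ‖v‖² / 2` for the whitened matrix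
`X`, whose squared column norms are the ridge scores, of total `T ≤ 2 k` (`sum_ridgeScore_le`).

Coverage follows from a potential argument (`sum_uncovered_le`). With `R` the projection orthogonal
to the columns drawn so far, the potential is the trace of the positive part of `R X Xᵀ R - η I`.
Drawing a column with probability proportional to its squared norm multiplies the expected potential
by at most `exp (-η / T)`, while an uncovered direction keeps it above `η`. Markov's inequality with
`η = 1 / 4` bounds the failure probability by `8 k exp (-r / (8 k))`.

On the hard instances, once the last index is sampled and `i` is not, the sampled rows of `A_i` and
`B` coincide and are nonzero, so `1` is the only minimizer; a union bound does the rest. -/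

namespace RidgeSampling

/-! ### Symmetric matrices with prescribed eigenvalues in a given eigenbasis -/

section Spectral

variable {d : ℕ} {M : Matrix (Fin d) (Fin d) ℝ}

/-- The symmetric matrix with the eigenvectors of `M` and the eigenvalues `a`. -/
noncomputable def spectralMap (hM : M.IsHermitian) (a : Fin d → ℝ) : Matrix (Fin d) (Fin d) ℝ :=
  (hM.eigenvectorUnitary : Matrix (Fin d) (Fin d) ℝ) * Matrix.diagonal a *
    star (hM.eigenvectorUnitary : Matrix (Fin d) (Fin d) ℝ)

theorem spectralMap_eigenvalues (hM : M.IsHermitian) : spectralMap hM hM.eigenvalues = M :=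
  (spectral_eq hM).symm

theorem spectralMap_mul (hM : M.IsHermitian) (a b : Fin d → ℝ) :
    spectralMap hM a * spectralMap hM b = spectralMap hM (fun i => a i * b i) :=
  conj_mul_conj hM a b

theorem spectralMap_mul_self (hM : M.IsHermitian) (a : Fin d → ℝ) :
    spectralMap hM a * M = spectralMap hM (fun i => a i * hM.eigenvalues i) :=
  (congrArg (fun N => spectralMap hM a * N) (spectral_eq hM)).trans (conj_mul_conj hM _ _)

theorem spectralMap_transpose (hM : M.IsHermitian) (a : Fin d → ℝ) :
    (spectralMap hM a)ᵀ = spectralMap hM a :=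
  transpose_conj hM a

theorem spectralMap_sub (hM : M.IsHermitian) (a b : Fin d → ℝ) :
    spectralMap hM a - spectralMap hM b = spectralMap hM (fun i => a i - b i) := by
  unfold spectralMap
  rw [← Matrix.sub_mul, ← Matrix.mul_sub, Matrix.diagonal_sub]

theorem smul_spectralMap (hM : M.IsHermitian) (c : ℝ) (a : Fin d → ℝ) :
    c • spectralMap hM a = spectralMap hM (fun i => c * a i) := by
  unfold spectralMap
  rw [← Matrix.smul_mul, ← Matrix.mul_smul, ← Matrix.diagonal_smul]
  rfl

theorem spectralMap_one (hM : M.IsHermitian) : spectralMap hM (fun _ => 1) = 1 := by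
  unfold spectralMap
  rw [Matrix.diagonal_one, Matrix.mul_one]
  exact Unitary.coe_mul_star_self _

theorem trace_spectralMap (hM : M.IsHermitian) (a : Fin d → ℝ) :
    (spectralMap hM a).trace = ∑ i, a i := by
  unfold spectralMap
  rw [Matrix.trace_mul_cycle, Unitary.coe_star_mul_self, Matrix.one_mul, Matrix.trace_diagonal]

theorem spectralMap_posSemidef (hM : M.IsHermitian) {a : Fin d → ℝ} (ha : ∀ i, 0 ≤ a i) :
    (spectralMap hM a).PosSemidef :=
  (PosSemidef.diagonal ha).mul_mul_conjTranspose_same _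

end Spectral

/-! ### Orthogonal projections, traces and positive parts. -/

section Projections

variable {d n : ℕ}

theorem posSemidef_of_proj {P : Matrix (Fin d) (Fin d) ℝ} (h1 : Pᵀ = P) (h2 : P * P = P) :
    P.PosSemidef := by
  have h := posSemidef_conjTranspose_mul_self P
  rwa [conjTranspose_eq_transpose_of_trivial, h1, h2] at h

theorem one_sub_proj {P : Matrix (Fin d) (Fin d) ℝ} (h1 : Pᵀ = P) (h2 : P * P = P) :
    (1 - P)ᵀ = 1 - P ∧ (1 - P) * (1 - P) = 1 - P := by
  refine ⟨by rw [transpose_sub, h1, transpose_one], ?_⟩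
  rw [Matrix.sub_mul, Matrix.mul_sub, Matrix.mul_sub, h2]; simp

theorem trace_proj_mul_nonneg {P Z : Matrix (Fin d) (Fin d) ℝ} (h1 : Pᵀ = P) (h2 : P * P = P)
    (hZ : Z.PosSemidef) : 0 ≤ (P * Z).trace := by
  have h := (hZ.mul_mul_conjTranspose_same P).trace_nonneg
  rwa [conjTranspose_eq_transpose_of_trivial, h1, Matrix.trace_mul_comm, ← Matrix.mul_assoc, h2]
    at h

theorem trace_proj_mul_le {P Z : Matrix (Fin d) (Fin d) ℝ} (h1 : Pᵀ = P) (h2 : P * P = P)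
    (hZ : Z.PosSemidef) : (P * Z).trace ≤ Z.trace := by
  have h := trace_proj_mul_nonneg (one_sub_proj h1 h2).1 (one_sub_proj h1 h2).2 hZ
  rw [Matrix.sub_mul, Matrix.one_mul, trace_sub] at h
  linarith

/-- The orthogonal projection onto the column space of `G`. -/
theorem exists_proj (G : Matrix (Fin d) (Fin n) ℝ) :
    ∃ (P : Matrix (Fin d) (Fin d) ℝ) (N : Matrix (Fin n) (Fin d) ℝ),
      Pᵀ = P ∧ P * P = P ∧ P * G = G ∧ P = G * N ∧ P.trace = G.rank := by
  have hM : (G * Gᵀ).IsHermitian := by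
    simp [Matrix.IsHermitian, conjTranspose_eq_transpose_of_trivial, transpose_mul]
  refine ⟨G * Gᵀ * pinv hM, Gᵀ * pinv hM, mul_pinv_transpose hM, ?_, ?_,
    Matrix.mul_assoc _ _ _, ?_⟩
  · rw [← Matrix.mul_assoc, mul_pinv_mul]
  · have h := mul_pinv_mul hM
    have h2 : (G * Gᵀ * pinv hM - 1) * (G * Gᴴ) = 0 := by
      rw [conjTranspose_eq_transpose_of_trivial, Matrix.sub_mul, h, Matrix.one_mul, sub_self]
    rw [mul_self_mul_conjTranspose_eq_zero, Matrix.sub_mul, Matrix.one_mul, sub_eq_zero] at h2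
    exact h2
  · rw [mul_pinv_eq]
    refine (trace_spectralMap hM _).trans ?_
    rw [← rank_self_mul_transpose G, hM.rank_eq_card_non_zero_eigs, Fintype.card_subtype,
      Finset.card_eq_sum_ones, Finset.sum_filter, Nat.cast_sum]
    refine Finset.sum_congr rfl fun i _ => ?_
    by_cases h : hM.eigenvalues i = 0 <;> simp [h]

/-- The positive part `Y` of a symmetric matrix `N`: among the positive semidefinite matrices
above `N` it has the least trace. -/
theorem exists_posPart {N : Matrix (Fin d) (Fin d) ℝ} (hN : N.IsHermitian) :
    ∃ Y : Matrix (Fin d) (Fin d) ℝ, Y.PosSemidef ∧ (Y - N).PosSemidef ∧ Y * N = Y * Y ∧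
      ∀ Z : Matrix (Fin d) (Fin d) ℝ, Z.PosSemidef → (Z - N).PosSemidef → Y.trace ≤ Z.trace := by
  refine ⟨spectralMap hN (fun i => max (hN.eigenvalues i) 0),
    spectralMap_posSemidef hN fun i => le_max_right _ _, ?_, ?_, fun Z hZ hZN => ?_⟩
  · have h : spectralMap hN (fun i => max (hN.eigenvalues i) 0) - N =
        spectralMap hN (fun i => max (hN.eigenvalues i) 0 - hN.eigenvalues i) := by
      rw [← spectralMap_sub, spectralMap_eigenvalues]
    rw [h]
    exact spectralMap_posSemidef hN fun i => sub_nonneg.2 (le_max_left _ _)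
  · rw [spectralMap_mul_self, spectralMap_mul]
    congr 1
    funext i
    rcases le_total (hN.eigenvalues i) 0 with h | h <;> simp [h]
  -- `E` projects onto the eigenvectors with positive eigenvalue, so `tr Y = tr (E N) ≤ tr (E Z) ≤
  -- tr Z`.
  · let E := spectralMap hN (fun i => if 0 < hN.eigenvalues i then 1 else 0)
    have h1 : Eᵀ = E := spectralMap_transpose hN _
    have h2 : E * E = E := by
      refine (spectralMap_mul hN _ _).trans ?_
      congr 1
      funext i
      split_ifs <;> simp
    have h3 : E * N = spectralMap hN (fun i => max (hN.eigenvalues i) 0) := by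
      refine (spectralMap_mul_self hN _).trans ?_
      congr 1
      funext i
      split_ifs with h
      · simp [h.le]
      · simp [not_lt.1 h]
    have h4 := trace_proj_mul_nonneg h1 h2 hZN
    rw [Matrix.mul_sub, trace_sub, h3] at h4
    linarith [trace_proj_mul_le h1 h2 hZ]

end Projections

/-! ### Covering by random columns -/

section Covering

variable {m n : ℕ}

/-- Some vector `v` fixed by `R` and orthogonal to the columns `s 0, …, s (r - 1)` of `X` has
`‖Xᵀ v‖² > 2 η ‖v‖²`. -/
def Uncovered (X : Matrix (Fin m) (Fin n) ℝ) (η : ℝ) (R : Matrix (Fin m) (Fin m) ℝ) {r : ℕ}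
    (s : Fin r → Fin n) : Prop :=
  ∃ v, R *ᵥ v = v ∧ (∀ t, X.col (s t) ⬝ᵥ v = 0) ∧
    2 * η * (v ⬝ᵥ v) < (Xᵀ *ᵥ v) ⬝ᵥ (Xᵀ *ᵥ v)

theorem dotProduct_self_nonneg {ι : Type*} [Fintype ι] (v : ι → ℝ) : 0 ≤ v ⬝ᵥ v := by
  simpa using dotProduct_star_self_nonneg v

theorem dotProduct_mulVec_of_symm {R : Matrix (Fin m) (Fin m) ℝ} (hR : Rᵀ = R)
    (u v : Fin m → ℝ) : (R *ᵥ u) ⬝ᵥ v = u ⬝ᵥ (R *ᵥ v) := by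
  rw [dotProduct_mulVec, ← mulVec_transpose, hR]

/-- The projection `R` followed by the projection along `R u`. -/
noncomputable def deflate (R : Matrix (Fin m) (Fin m) ℝ) (u : Fin m → ℝ) :
    Matrix (Fin m) (Fin m) ℝ :=
  R - ((R *ᵥ u) ⬝ᵥ (R *ᵥ u))⁻¹ • vecMulVec (R *ᵥ u) (R *ᵥ u)

theorem deflate_transpose {R : Matrix (Fin m) (Fin m) ℝ} (h1 : Rᵀ = R) (u : Fin m → ℝ) :
    (deflate R u)ᵀ = deflate R u := by
  rw [deflate, transpose_sub, h1, transpose_smul, transpose_vecMulVec]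

theorem deflate_mul {R : Matrix (Fin m) (Fin m) ℝ} (h1 : Rᵀ = R) (h2 : R * R = R)
    (u : Fin m → ℝ) : deflate R u * R = deflate R u := by
  rw [deflate, Matrix.sub_mul, h2, Matrix.smul_mul, vecMulVec_mul, ← mulVec_transpose, h1,
    mulVec_mulVec, h2]

theorem mul_deflate {R : Matrix (Fin m) (Fin m) ℝ} (h2 : R * R = R)
    (u : Fin m → ℝ) : R * deflate R u = deflate R u := by
  rw [deflate, Matrix.mul_sub, h2, Matrix.mul_smul, mul_vecMulVec,
    mulVec_mulVec, h2]

/-- The case `R u = 0` is included: the inverse of `0` is `0`, and deflation then leaves `R`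
unchanged. -/
theorem deflate_mul_deflate {R : Matrix (Fin m) (Fin m) ℝ} (h1 : Rᵀ = R) (h2 : R * R = R)
    (u : Fin m → ℝ) : deflate R u * deflate R u = deflate R u := by
  have h : deflate R u *ᵥ (R *ᵥ u) = 0 := by
    rw [deflate, sub_mulVec, mulVec_mulVec, h2, smul_mulVec, vecMulVec_mulVec]
    by_cases h0 : (R *ᵥ u) ⬝ᵥ (R *ᵥ u) = 0
    · rw [dotProduct_self_eq_zero.1 h0]; simp
    · ext i
      simp
      field_simp
      ring
  conv_lhs => arg 2; rw [deflate]
  rw [Matrix.mul_sub, deflate_mul h1 h2, Matrix.mul_smul, mul_vecMulVec, h]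
  simp

theorem deflate_mulVec {R : Matrix (Fin m) (Fin m) ℝ} (h1 : Rᵀ = R) {u v : Fin m → ℝ}
    (hv : R *ᵥ v = v) (huv : u ⬝ᵥ v = 0) : deflate R u *ᵥ v = v := by
  rw [deflate, sub_mulVec, hv, smul_mulVec, vecMulVec_mulVec, 
    dotProduct_mulVec_of_symm h1 u v, hv, huv]
  simp

/-- The same `v` is a witness: being fixed by `R` and orthogonal to the first column drawn, it is
fixed by the deflated projection. This is the recursion behind the covering bound. -/
theorem Uncovered.deflate {X : Matrix (Fin m) (Fin n) ℝ} {η : ℝ} {R : Matrix (Fin m) (Fin m) ℝ}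
    (h1 : Rᵀ = R) {r : ℕ} {a : Fin n} {s : Fin r → Fin n}
    (h : Uncovered X η R (Fin.cons a s : Fin (r + 1) → Fin n)) :
    Uncovered X η (deflate R (X.col a)) s := by
  obtain ⟨v, hv, hs, hlt⟩ := h
  exact ⟨v, deflate_mulVec h1 hv (by simpa using hs 0), fun t => by simpa using hs t.succ, hlt⟩

theorem dotProduct_mulVec_le_trace {Z : Matrix (Fin m) (Fin m) ℝ} (hZ : Z.PosSemidef)
    (v : Fin m → ℝ) : v ⬝ᵥ (Z *ᵥ v) ≤ (v ⬝ᵥ v) * Z.trace := by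
  have h1 : (1 : Matrix (Fin m) (Fin m) ℝ)ᵀ = 1 := transpose_one
  have h2 : (1 : Matrix (Fin m) (Fin m) ℝ) * 1 = 1 := Matrix.mul_one _
  by_cases h0 : v ⬝ᵥ v = 0
  · rw [dotProduct_self_eq_zero.1 h0]; simp
  have hpos : 0 < v ⬝ᵥ v := lt_of_le_of_ne (dotProduct_self_nonneg v) (Ne.symm h0)
  have h := trace_proj_mul_nonneg (deflate_transpose h1 v) (deflate_mul_deflate h1 h2 v) hZ
  rw [RidgeSampling.deflate, Matrix.sub_mul, Matrix.one_mul, Matrix.smul_mul, vecMulVec_mul,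
    one_mulVec, trace_sub, trace_smul, trace_vecMulVec, dotProduct_comm v (v ᵥ* Z),
    ← dotProduct_mulVec, smul_eq_mul, inv_mul_eq_div, sub_nonneg, div_le_iff₀ hpos] at h
  linarith

theorem trace_deflate_mul {R Y : Matrix (Fin m) (Fin m) ℝ} (u : Fin m → ℝ) :
    (deflate R u * Y).trace =
      (R * Y).trace - ((R *ᵥ u) ⬝ᵥ (R *ᵥ u))⁻¹ * ((R *ᵥ u) ⬝ᵥ (Y *ᵥ (R *ᵥ u))) := by
  rw [deflate, Matrix.sub_mul, Matrix.smul_mul, vecMulVec_mul,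
    trace_sub, trace_smul, trace_vecMulVec, dotProduct_comm _ (_ ᵥ* Y),
    ← dotProduct_mulVec, smul_eq_mul]

theorem sum_dotProduct_col {X : Matrix (Fin m) (Fin n) ℝ} {R Y : Matrix (Fin m) (Fin m) ℝ}
    (h1 : Rᵀ = R) : ∑ a, (R *ᵥ X.col a) ⬝ᵥ (Y *ᵥ (R *ᵥ X.col a)) =
      (Y * (R * (X * Xᵀ) * R)).trace := by
  have h : ∀ a, (R *ᵥ X.col a) ⬝ᵥ (Y *ᵥ (R *ᵥ X.col a)) = (Xᵀ * (R * Y * R * X)) a a := by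
    intro a
    rw [dotProduct_mulVec_of_symm h1, mulVec_mulVec, mulVec_mulVec]
    rfl
  rw [Finset.sum_congr rfl fun a _ => h a]
  change (Xᵀ * (R * Y * R * X)).trace = _
  rw [Matrix.trace_mul_comm, Matrix.mul_assoc, Matrix.mul_assoc, Matrix.mul_assoc,
    Matrix.trace_mul_comm]
  simp only [Matrix.mul_assoc]

/-- One step of the potential argument. With `g = R u`, deflation lowers `tr (R Y)` by `gᵀ Y g /
‖g‖²`, and `u` is drawn with probability `‖u‖² / T ≥ ‖g‖² / T`. The expected drop is therefore at
least `tr (Y R X Xᵀ R) / T = (tr Y² + η tr Y) / T`, which is at least `η tr Y / T`. -/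
theorem expected_trace_deflate_le {X : Matrix (Fin m) (Fin n) ℝ} {p : Fin n → ℝ}
    (hsum : ∑ a, p a = 1) {T : ℝ} (hT : 0 < T)
    (hpT : ∀ a, p a * T = X.col a ⬝ᵥ X.col a) {η : ℝ} {R Y : Matrix (Fin m) (Fin m) ℝ}
    (h1 : Rᵀ = R) (h2 : R * R = R) (hY : Y.PosSemidef)
    (hYN : Y * (R * (X * Xᵀ) * R - η • 1) = Y * Y) :
    ∑ a, p a * (deflate R (X.col a) * Y).trace ≤ Real.exp (-η / T) * Y.trace := by
  have key : ∀ a, (R *ᵥ X.col a) ⬝ᵥ (Y *ᵥ (R *ᵥ X.col a)) / T ≤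
      p a * (((R *ᵥ X.col a) ⬝ᵥ (R *ᵥ X.col a))⁻¹ *
        ((R *ᵥ X.col a) ⬝ᵥ (Y *ᵥ (R *ᵥ X.col a)))) := by
    intro a
    set u := X.col a
    by_cases h0 : (R *ᵥ u) ⬝ᵥ (R *ᵥ u) = 0
    · rw [dotProduct_self_eq_zero.1 h0]; simp
    have hpos : 0 < (R *ᵥ u) ⬝ᵥ (R *ᵥ u) :=
      lt_of_le_of_ne (dotProduct_self_nonneg _) (Ne.symm h0)
    have hYg : 0 ≤ (R *ᵥ u) ⬝ᵥ (Y *ᵥ (R *ᵥ u)) := by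
      simpa using hY.dotProduct_mulVec_nonneg (R *ᵥ u)
    have hle : (R *ᵥ u) ⬝ᵥ (R *ᵥ u) ≤ u ⬝ᵥ u := by
      obtain ⟨h3, h4⟩ := one_sub_proj h1 h2
      have h := dotProduct_self_nonneg ((1 - R) *ᵥ u)
      rw [dotProduct_mulVec_of_symm h3, mulVec_mulVec, h4, sub_mulVec, one_mulVec,
        dotProduct_sub] at h
      rw [dotProduct_mulVec_of_symm h1, mulVec_mulVec, h2]
      linarith
    have hpa : p a = u ⬝ᵥ u / T := by rw [eq_div_iff hT.ne', hpT]
    have hge : 1 ≤ (u ⬝ᵥ u) * ((R *ᵥ u) ⬝ᵥ (R *ᵥ u))⁻¹ := by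
      rw [← div_eq_mul_inv, le_div_iff₀ hpos, one_mul]; exact hle
    rw [hpa]
    calc _ = 1 * ((R *ᵥ u) ⬝ᵥ (Y *ᵥ (R *ᵥ u)) / T) := (one_mul _).symm
      _ ≤ _ := mul_le_mul_of_nonneg_right hge (div_nonneg hYg hT.le)
      _ = _ := by ring
  have htr : η * Y.trace ≤ (Y * (R * (X * Xᵀ) * R)).trace := by
    have h := congrArg trace hYN
    rw [Matrix.mul_sub, trace_sub, Matrix.mul_smul, Matrix.mul_one, trace_smul, smul_eq_mul] at h
    have h5 := (posSemidef_conjTranspose_mul_self Y).trace_nonneg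
    rw [hY.isHermitian] at h5
    linarith
  have hsum2 := Finset.sum_le_sum fun a (_ : a ∈ Finset.univ) => key a
  rw [← Finset.sum_div, sum_dotProduct_col h1] at hsum2
  have hYt := hY.trace_nonneg
  calc ∑ a, p a * (deflate R (X.col a) * Y).trace
      = ∑ a, (p a * (R * Y).trace - p a * (((R *ᵥ X.col a) ⬝ᵥ (R *ᵥ X.col a))⁻¹ *
        ((R *ᵥ X.col a) ⬝ᵥ (Y *ᵥ (R *ᵥ X.col a))))) :=
        Finset.sum_congr rfl fun a _ => by rw [trace_deflate_mul, mul_sub]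
    _ ≤ (R * Y).trace - (Y * (R * (X * Xᵀ) * R)).trace / T := by
        rw [Finset.sum_sub_distrib, ← Finset.sum_mul, hsum, one_mul]
        linarith
    _ ≤ Y.trace - η * Y.trace / T :=
        sub_le_sub (trace_proj_mul_le h1 h2 hY) (div_le_div_of_nonneg_right htr hT.le)
    _ = (-η / T + 1) * Y.trace := by ring
    _ ≤ _ := mul_le_mul_of_nonneg_right (Real.add_one_le_exp _) hYt

-- Induction on the number of draws, conditioning on the first index. Allowing any positive
-- semidefinite majorant `Z` of `R X Xᵀ R - η I`, not just its positive part, lets the deflated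
-- positive part serve as the next majorant.
open Classical in
theorem sum_uncovered_le {X : Matrix (Fin m) (Fin n) ℝ} {p : Fin n → ℝ}
    (hp : ∀ a, 0 ≤ p a) (hsum : ∑ a, p a = 1) {T : ℝ} (hT : 0 < T)
    (hpT : ∀ a, p a * T = X.col a ⬝ᵥ X.col a) {η : ℝ} (hη : 0 < η) (r : ℕ) :
    ∀ R Z : Matrix (Fin m) (Fin m) ℝ, Rᵀ = R → R * R = R → Z.PosSemidef →
      (Z - (R * (X * Xᵀ) * R - η • 1)).PosSemidef →
      ∑ s : Fin r → Fin n, (if Uncovered X η R s then ∏ t, p (s t) else 0) ≤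
        Real.exp (-η / T) ^ r * (Z.trace / η) := by
  induction r with
  | zero =>
    intro R Z h1 h2 hZ hZN
    have hZt := hZ.trace_nonneg
    simp only [Finset.univ_unique, Finset.sum_singleton, Finset.univ_eq_empty,
      Finset.prod_empty, pow_zero, one_mul]
    split_ifs with h
    · obtain ⟨v, hv, -, hlt⟩ := h
      -- An uncovered `v` has `vᵀ Z v > (2 η - η) ‖v‖²`, hence `tr Z > η`: the Markov step, and the
      -- reason for the factor `2` in `Uncovered`.
      have hq := hZN.dotProduct_mulVec_nonneg v
      have h3 : v ⬝ᵥ ((R * (X * Xᵀ) * R) *ᵥ v) = (Xᵀ *ᵥ v) ⬝ᵥ (Xᵀ *ᵥ v) := by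
        rw [← mulVec_mulVec, hv, ← mulVec_mulVec, ← dotProduct_mulVec_of_symm h1, hv,
          ← mulVec_mulVec, dotProduct_mulVec, ← mulVec_transpose]
      simp only [star_trivial, sub_mulVec, dotProduct_sub, h3, smul_mulVec, one_mulVec,
        dotProduct_smul, smul_eq_mul] at hq
      have h4 := dotProduct_mulVec_le_trace hZ v
      have hv0 := dotProduct_self_nonneg v
      rw [le_div_iff₀ hη]
      by_contra hcon
      nlinarith
    · exact div_nonneg hZt hη.le
  | succ r ih =>
    intro R Z h1 h2 hZ hZN
    have hNh : (R * (X * Xᵀ) * R - η • 1).IsHermitian := by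
      simp [Matrix.IsHermitian, conjTranspose_eq_transpose_of_trivial, transpose_mul,
        h1, Matrix.mul_assoc]
    -- The contraction needs `Y N = Y²`, so `Z` is replaced by the positive part, whose trace is no
    -- larger.
    obtain ⟨Y, hY, hYN, hYY, hmin⟩ := exists_posPart hNh
    have hstep : ∀ a, ∑ s : Fin r → Fin n,
        (if Uncovered X η R (Fin.cons a s : Fin (r + 1) → Fin n) then
          ∏ t, p ((Fin.cons a s : Fin (r + 1) → Fin n) t) else 0) ≤
        p a * (Real.exp (-η / T) ^ r * ((deflate R (X.col a) * Y).trace / η)) := by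
      intro a
      have h1' := deflate_transpose h1 (X.col a)
      have h2' := deflate_mul_deflate h1 h2 (X.col a)
      have hY' := hY.mul_mul_conjTranspose_same (deflate R (X.col a))
      rw [conjTranspose_eq_transpose_of_trivial, h1'] at hY'
      have h3 : (deflate R (X.col a) * Y * deflate R (X.col a) -
          (deflate R (X.col a) * (X * Xᵀ) * deflate R (X.col a) - η • 1)).PosSemidef := by
        have h4 := hYN.mul_mul_conjTranspose_same (deflate R (X.col a))
        rw [conjTranspose_eq_transpose_of_trivial, h1'] at h4
        obtain ⟨h5, h6⟩ := one_sub_proj h1' h2'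
        -- Conjugating `-η I` by the deflated projection `R'` leaves only `-η R'`; adding `η (1 -
        -- R')` restores the full identity.
        have h7 := h4.add ((posSemidef_of_proj h5 h6).smul hη.le)
        convert h7 using 1
        have e1 : deflate R (X.col a) * (R * (X * Xᵀ) * R) * deflate R (X.col a) =
            deflate R (X.col a) * (X * Xᵀ) * deflate R (X.col a) := by
          rw [← Matrix.mul_assoc, ← Matrix.mul_assoc, deflate_mul h1 h2,
            Matrix.mul_assoc _ R, mul_deflate h2]
        rw [Matrix.mul_sub, Matrix.sub_mul, Matrix.mul_sub, Matrix.sub_mul, e1, Matrix.mul_smul,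
          Matrix.smul_mul, Matrix.mul_one, h2', smul_sub]
        abel
      have h8 := ih _ _ h1' h2' hY' h3
      rw [Matrix.trace_mul_comm, ← Matrix.mul_assoc, h2'] at h8
      refine le_trans ?_ (mul_le_mul_of_nonneg_left h8 (hp a))
      rw [Finset.mul_sum]
      refine Finset.sum_le_sum fun s _ => ?_
      have hpr : 0 ≤ ∏ t, p (s t) := Finset.prod_nonneg fun t _ => hp _
      rw [Fin.prod_univ_succ]
      simp only [Fin.cons_zero, Fin.cons_succ]
      by_cases hU : Uncovered X η R (Fin.cons a s : Fin (r + 1) → Fin n)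
      · rw [if_pos hU, if_pos (hU.deflate h1)]
      · rw [if_neg hU]
        split_ifs
        · exact mul_nonneg (hp a) hpr
        · simp
    rw [← (Fin.consEquiv fun _ => Fin n).sum_comp, Fintype.sum_prod_type]
    refine (Finset.sum_le_sum fun a _ => hstep a).trans ?_
    have hE := expected_trace_deflate_le hsum hT hpT h1 h2 hY hYY
    calc _ = Real.exp (-η / T) ^ r * ((∑ a, p a * (deflate R (X.col a) * Y).trace) / η) := by
          rw [Finset.sum_div, Finset.mul_sum]
          exact Finset.sum_congr rfl fun a _ => by ring
      _ ≤ Real.exp (-η / T) ^ r * (Real.exp (-η / T) * Z.trace / η) := by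
          refine mul_le_mul_of_nonneg_left (div_le_div_of_nonneg_right (hE.trans ?_) hη.le)
            (by positivity)
          exact mul_le_mul_of_nonneg_left (hmin Z hZ hZN) (Real.exp_pos _).le
      _ = _ := by ring

end Covering

/-! ### Random samples -/

section Sampling

variable {Ω : Type*} [MeasurableSpace Ω] {μ : Measure Ω} {r n : ℕ} {p : Fin n → ℝ}
  {I : Fin r → Ω → Fin n}

theorem IsIIDSample.measureReal_inter (h : IsIIDSample μ p I) (S : Fin r → Set (Fin n)) :
    μ.real (⋂ t, I t ⁻¹' S t) = ∏ t, μ.real (I t ⁻¹' S t) := by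
  have h1 := h.indep.measure_inter_preimage_eq_mul Finset.univ (sets := S)
    (fun t _ => (Set.toFinite _).measurableSet)
  simp only [Finset.mem_univ, Set.iInter_true] at h1
  rw [measureReal_def, h1, ENNReal.toReal_prod]
  rfl

theorem IsIIDSample.measureReal_eq (h : IsIIDSample μ p I) (s : Fin r → Fin n) :
    μ.real {ω | (fun t => I t ω) = s} = ∏ t, p (s t) := by
  have h1 : {ω | (fun t => I t ω) = s} = ⋂ t, I t ⁻¹' {s t} := by
    ext ω
    simp [funext_iff]
  rw [h1, h.measureReal_inter]
  exact Finset.prod_congr rfl fun t _ => h.law t (s t)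

theorem IsIIDSample.measurableSet (h : IsIIDSample μ p I) (Q : (Fin r → Fin n) → Prop) :
    MeasurableSet {ω | Q fun t => I t ω} :=
  (measurable_pi_lambda _ h.measurable) (Set.toFinite {s | Q s}).measurableSet

-- Probabilities become finite sums over samples, which the covering bound handles by induction
-- without conditional expectations.
open Classical in
theorem IsIIDSample.measureReal_setOf [IsProbabilityMeasure μ] (h : IsIIDSample μ p I)
    (Q : (Fin r → Fin n) → Prop) :
    μ.real {ω | Q fun t => I t ω} = ∑ s, if Q s then ∏ t, p (s t) else 0 := by
  have h1 : {ω | Q fun t => I t ω} =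
      ⋃ s ∈ Finset.univ.filter Q, {ω | (fun t => I t ω) = s} := by
    ext ω
    simp
  rw [h1, measureReal_biUnion_finset, Finset.sum_filter]
  · exact Finset.sum_congr rfl fun s _ => by rw [h.measureReal_eq]
  · intro s _ s' _ hss
    refine Set.disjoint_left.2 fun ω h1 h2 => hss ?_
    exact (show _ = s from h1).symm.trans h2
  · exact fun s _ => h.measurableSet fun u => u = s

end Sampling

/-! ### The rank-constrained regression -/

section Regression

variable {d n k : ℕ}

theorem norm_sq_eq_sum (M : Matrix (Fin d) (Fin n) ℝ) : ‖M‖ ^ 2 = ∑ i, ∑ j, M i j ^ 2 := by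
  have h0 : 0 ≤ ∑ i, ∑ j, ‖M i j‖ ^ (2 : ℝ) := by positivity
  rw [frobenius_norm_def, ← Real.sqrt_eq_rpow, Real.sq_sqrt h0]
  simp

theorem norm_sq_eq_trace (M : Matrix (Fin d) (Fin n) ℝ) : ‖M‖ ^ 2 = (M * Mᵀ).trace := by
  rw [norm_sq_eq_sum]
  simp [Matrix.trace, Matrix.mul_apply, sq]

theorem norm_sq_add_of_orthogonal {M N : Matrix (Fin d) (Fin n) ℝ} (h : M * Nᵀ = 0) :
    ‖M + N‖ ^ 2 = ‖M‖ ^ 2 + ‖N‖ ^ 2 := by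
  have h' : N * Mᵀ = 0 := by
    have := congrArg transpose h
    rwa [transpose_mul, transpose_transpose, transpose_zero] at this
  simp only [norm_sq_eq_trace, transpose_add, Matrix.add_mul, Matrix.mul_add, h, h', trace_add]
  simp

theorem bddBelow_costs (Q : Matrix (Fin d) (Fin n) ℝ → Prop) (B : Matrix (Fin d) (Fin n) ℝ) :
    BddBelow {c : ℝ | ∃ C : Matrix (Fin d) (Fin n) ℝ, Q C ∧ c = ‖B - C‖ ^ 2} :=
  ⟨0, by rintro c ⟨C, -, rfl⟩; positivity⟩

theorem opt_eq_of_mem_solutions {A : Matrix (Fin k) (Fin n) ℝ} {B : Matrix (Fin d) (Fin n) ℝ}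
    {X : Matrix (Fin d) (Fin k) ℝ} (h : X ∈ solutions A B) : opt A B = ‖X * A - B‖ ^ 2 := by
  refine IsLeast.csInf_eq ⟨⟨X, h.1, rfl⟩, ?_⟩
  rintro c ⟨Y, hY, rfl⟩
  exact h.2 Y hY

/-- Solving the regression is projecting `B` to the row space of `A`. -/
theorem exists_solution (A : Matrix (Fin k) (Fin n) ℝ) (B : Matrix (Fin d) (Fin n) ℝ) :
    ∃ (P : Matrix (Fin n) (Fin n) ℝ) (N : Matrix (Fin n) (Fin k) ℝ), Pᵀ = P ∧ P * P = P ∧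
      P = N * A ∧ P.trace ≤ k ∧ B * N ∈ solutions A B := by
  obtain ⟨P, N, h1, h2, h3, h4, h5⟩ := exists_proj Aᵀ
  have h6 : A * P = A := by
    have := congrArg transpose h3
    rwa [transpose_mul, h1, transpose_transpose] at this
  have h7 : P = Nᵀ * A := by
    have := congrArg transpose h4
    rwa [transpose_mul, h1, transpose_transpose] at this
  refine ⟨P, Nᵀ, h1, h2, h7, ?_, rank_le_width _, fun Y _ => ?_⟩
  · rw [h5]
    exact_mod_cast rank_le_width _
  · have h8 : Y * A - B = (Y * A - B * Nᵀ * A) + (B * Nᵀ * A - B) := by abel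
    have h9 : (Y * A - B * Nᵀ * A) * (B * Nᵀ * A - B)ᵀ = 0 := by
      have e1 : Y * A - B * Nᵀ * A = (Y * A - B * P) * P := by
        rw [Matrix.mul_assoc B, ← h7, Matrix.sub_mul, Matrix.mul_assoc, h6, Matrix.mul_assoc, h2]
      have e2 : P * (B * Nᵀ * A - B)ᵀ = 0 := by
        rw [Matrix.mul_assoc B, ← h7, transpose_sub, transpose_mul, h1, Matrix.mul_sub,
          ← Matrix.mul_assoc, h2, sub_self]
      rw [e1, Matrix.mul_assoc, e2, Matrix.mul_zero]
    rw [h8, norm_sq_add_of_orthogonal h9]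
    linarith [sq_nonneg ‖Y * A - B * Nᵀ * A‖]

theorem ridgeParam_nonneg (B : Matrix (Fin d) (Fin n) ℝ) (k : ℕ) : 0 ≤ ridgeParam B k := by
  refine div_nonneg (Real.sInf_nonneg ?_) (Nat.cast_nonneg k)
  rintro c ⟨C, -, rfl⟩
  positivity

theorem mul_ridgeParam_le {B C : Matrix (Fin d) (Fin n) ℝ} (hk : 0 < k) (hC : C.rank ≤ k) :
    k * ridgeParam B k ≤ ‖B - C‖ ^ 2 := by
  rw [ridgeParam, mul_div_cancel₀ _ (by positivity)]
  exact csInf_le (bddBelow_costs _ B) ⟨C, hC, rfl⟩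

theorem exists_norm_sq_lt {B : Matrix (Fin d) (Fin n) ℝ} (hk : 0 < k) {e : ℝ} (he : 0 < e) :
    ∃ C : Matrix (Fin d) (Fin n) ℝ, C.rank ≤ k ∧ ‖B - C‖ ^ 2 < k * ridgeParam B k + e := by
  have hne : {c : ℝ | ∃ C : Matrix (Fin d) (Fin n) ℝ, C.rank ≤ k ∧ c = ‖B - C‖ ^ 2}.Nonempty :=
    ⟨_, 0, by simp, rfl⟩
  obtain ⟨c, ⟨C, hC, rfl⟩, hlt⟩ := exists_lt_of_csInf_lt hne (lt_add_of_pos_right _ he)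
  refine ⟨C, hC, ?_⟩
  rwa [ridgeParam, mul_div_cancel₀ _ (by positivity)]

theorem mulVec_dotProduct (M : Matrix (Fin d) (Fin n) ℝ) (u : Fin n → ℝ) (v : Fin d → ℝ) :
    (M *ᵥ u) ⬝ᵥ v = u ⬝ᵥ (Mᵀ *ᵥ v) := by
  rw [dotProduct_mulVec, vecMul_transpose]

/-- If no direction orthogonal to the range of the projection `Q` carries more than `lam` of
`B`, then the part of `B` outside that range has operator norm at most `√lam`. -/
theorem dotProduct_compl_mulVec_le {Q : Matrix (Fin d) (Fin d) ℝ} (h1 : Qᵀ = Q) (h2 : Q * Q = Q)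
    {B : Matrix (Fin d) (Fin n) ℝ} {lam : ℝ} (hlam : 0 ≤ lam)
    (h : ∀ y, Q *ᵥ y = 0 → (Bᵀ *ᵥ y) ⬝ᵥ (Bᵀ *ᵥ y) ≤ lam * (y ⬝ᵥ y)) (q : Fin n → ℝ) :
    (((1 - Q) * B) *ᵥ q) ⬝ᵥ (((1 - Q) * B) *ᵥ q) ≤ lam * (q ⬝ᵥ q) := by
  obtain ⟨h3, h4⟩ := one_sub_proj h1 h2
  set z := ((1 - Q) * B) *ᵥ q with hz
  have hQz : Q *ᵥ z = 0 := by
    rw [hz, mulVec_mulVec, ← Matrix.mul_assoc, Matrix.mul_sub, h2, Matrix.mul_one, sub_self,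
      Matrix.zero_mul, zero_mulVec]
  -- As `Q z = 0`, the projection drops out; Cauchy–Schwarz and the hypothesis at `y = z` then leave
  -- one factor `‖z‖²` to cancel.
  have hzz : z ⬝ᵥ z = q ⬝ᵥ (Bᵀ *ᵥ z) := by
    conv_lhs => rw [hz]
    rw [mulVec_dotProduct, transpose_mul, h3, ← mulVec_mulVec, sub_mulVec, one_mulVec, hQz,
      sub_zero]
  have hB := h z hQz
  have hz0 := dotProduct_self_nonneg z
  have hq0 := dotProduct_self_nonneg q
  have hcs : (q ⬝ᵥ (Bᵀ *ᵥ z)) ^ 2 ≤ (q ⬝ᵥ q) * ((Bᵀ *ᵥ z) ⬝ᵥ (Bᵀ *ᵥ z)) := by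
    simpa [dotProduct, sq] using
      Finset.sum_mul_sq_le_sq_mul_sq Finset.univ q (Bᵀ *ᵥ z)
  rw [← hzz] at hcs
  rcases hz0.eq_or_lt with h0 | h0
  · rw [← h0]
    exact mul_nonneg hlam hq0
  · have h5 : (z ⬝ᵥ z) ^ 2 ≤ (lam * (q ⬝ᵥ q)) * (z ⬝ᵥ z) := by
      refine hcs.trans ((mul_le_mul_of_nonneg_left hB hq0).trans (le_of_eq ?_))
      ring
    rw [sq] at h5
    exact le_of_mul_le_mul_right h5 h0

theorem norm_sq_eq_sum_dotProduct (M : Matrix (Fin d) (Fin n) ℝ) :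
    ‖M‖ ^ 2 = ∑ j, M.col j ⬝ᵥ M.col j := by
  rw [norm_sq_eq_sum, Finset.sum_comm]
  simp [dotProduct, sq]

/-- Projecting the columns of the optimal solution to a subspace that captures `B` up to the
ridge parameter at most doubles the cost. -/
theorem norm_sq_proj_le {A : Matrix (Fin k) (Fin n) ℝ} {B : Matrix (Fin d) (Fin n) ℝ} (hk : 0 < k)
    {P : Matrix (Fin n) (Fin n) ℝ} {N : Matrix (Fin n) (Fin k) ℝ} (hP1 : Pᵀ = P) (hP2 : P * P = P)
    (hPN : P = N * A) (hPk : P.trace ≤ k) (hsol : B * N ∈ solutions A B)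
    {Q : Matrix (Fin d) (Fin d) ℝ} (h1 : Qᵀ = Q) (h2 : Q * Q = Q)
    (h : ∀ y, Q *ᵥ y = 0 → (Bᵀ *ᵥ y) ⬝ᵥ (Bᵀ *ᵥ y) ≤ ridgeParam B k * (y ⬝ᵥ y)) :
    ‖Q * (B * N) * A - B‖ ^ 2 ≤ 2 * opt A B := by
  have hopt : opt A B = ‖B * P - B‖ ^ 2 := by
    rw [opt_eq_of_mem_solutions hsol, Matrix.mul_assoc, ← hPN]
  have hlam := ridgeParam_nonneg B k
  have hk1 : k * ridgeParam B k ≤ opt A B := by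
    rw [hopt, ← norm_neg, neg_sub]
    refine mul_ridgeParam_le hk ?_
    rw [hPN, ← Matrix.mul_assoc]
    exact (rank_mul_le_left _ _).trans (rank_le_width _)
  have e1 : Q * (B * N) * A - B = -((1 - Q) * B * P) + (B * P - B) := by
    rw [Matrix.mul_assoc Q, Matrix.mul_assoc B, ← hPN, Matrix.sub_mul, Matrix.one_mul,
      Matrix.sub_mul, Matrix.mul_assoc Q]
    abel
  have e2 : -((1 - Q) * B * P) * (B * P - B)ᵀ = 0 := by
    rw [transpose_sub, transpose_mul, hP1, Matrix.mul_sub, Matrix.neg_mul, Matrix.neg_mul,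
      Matrix.mul_assoc _ P, ← Matrix.mul_assoc P P, hP2, Matrix.mul_assoc _ P, sub_self]
  have e3 : ‖(1 - Q) * B * P‖ ^ 2 ≤ k * ridgeParam B k := by
    rw [norm_sq_eq_sum_dotProduct]
    calc _ ≤ ∑ j, ridgeParam B k * (P.col j ⬝ᵥ P.col j) :=
          Finset.sum_le_sum fun j _ => dotProduct_compl_mulVec_le h1 h2 hlam h (P.col j)
      _ = ridgeParam B k * P.trace := by
          rw [← Finset.mul_sum, ← norm_sq_eq_sum_dotProduct, norm_sq_eq_trace, hP1, hP2]
      _ ≤ ridgeParam B k * k := mul_le_mul_of_nonneg_left hPk hlam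
      _ = _ := mul_comm _ _
  rw [e1, norm_sq_add_of_orthogonal e2, norm_neg, ← hopt]
  linarith

end Regression

/-! ### The columns of `B` in the metric of `B Bᵀ + λ I` -/

section Whitening

variable {d n : ℕ} (B : Matrix (Fin d) (Fin n) ℝ) (k : ℕ)

/-- The eigenvalues of `B Bᵀ + λ I`. -/
noncomputable abbrev ridgeEigenvalues : Fin d → ℝ := (ridgeGram_isHermitian B k).eigenvalues

/-- The orthogonal matrix of the eigenvectors of `B Bᵀ + λ I`. -/
noncomputable abbrev ridgeBasis : Matrix (Fin d) (Fin d) ℝ :=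
  ((ridgeGram_isHermitian B k).eigenvectorUnitary : Matrix (Fin d) (Fin d) ℝ)

/-- `(B Bᵀ + λ I)^{-1/2} B`, in coordinates with respect to the eigenvectors. -/
noncomputable def whiten : Matrix (Fin d) (Fin n) ℝ :=
  Matrix.diagonal (fun i => (√(ridgeEigenvalues B k i))⁻¹) * (ridgeBasis B k)ᵀ * B

theorem star_ridgeBasis : star (ridgeBasis B k) = (ridgeBasis B k)ᵀ := by
  rw [star_eq_conjTranspose, conjTranspose_eq_transpose_of_trivial]

theorem ridgeBasis_transpose_mul : (ridgeBasis B k)ᵀ * ridgeBasis B k = 1 := by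
  rw [← star_ridgeBasis]
  exact Unitary.coe_star_mul_self _

theorem spectralMap_ridge (a : Fin d → ℝ) : spectralMap (ridgeGram_isHermitian B k) a =
    ridgeBasis B k * Matrix.diagonal a * (ridgeBasis B k)ᵀ := by
  rw [← star_ridgeBasis]
  rfl

theorem gram_eq_spectralMap : B * Bᵀ = spectralMap (ridgeGram_isHermitian B k)
    (fun i => ridgeEigenvalues B k i - ridgeParam B k) := by
  have h1 : spectralMap (ridgeGram_isHermitian B k) (fun _ => ridgeParam B k) =
      ridgeParam B k • (1 : Matrix (Fin d) (Fin d) ℝ) := by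
    rw [← spectralMap_one (ridgeGram_isHermitian B k), smul_spectralMap]
    simp only [mul_one]
  rw [← spectralMap_sub, spectralMap_eigenvalues, h1, ridgeGram, add_sub_cancel_right]

theorem ridgeBasis_conj (a : Fin d → ℝ) :
    (ridgeBasis B k)ᵀ * spectralMap (ridgeGram_isHermitian B k) a * ridgeBasis B k =
      Matrix.diagonal a := by
  have h := ridgeBasis_transpose_mul B k
  rw [spectralMap_ridge, Matrix.mul_assoc, Matrix.mul_assoc _ _ (ridgeBasis B k), h,
    Matrix.mul_one, ← Matrix.mul_assoc, h, Matrix.one_mul]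

theorem ridgeParam_le_ridgeEigenvalues (i : Fin d) :
    ridgeParam B k ≤ ridgeEigenvalues B k i := by
  have h := (posSemidef_self_mul_conjTranspose B).conjTranspose_mul_mul_same (ridgeBasis B k)
  rw [conjTranspose_eq_transpose_of_trivial, conjTranspose_eq_transpose_of_trivial,
    gram_eq_spectralMap B k, ridgeBasis_conj, posSemidef_diagonal_iff] at h
  exact sub_nonneg.1 (h i)

theorem ridgeEigenvalues_nonneg (i : Fin d) : 0 ≤ ridgeEigenvalues B k i :=
  (ridgeParam_nonneg B k).trans (ridgeParam_le_ridgeEigenvalues B k i)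

/-- Ridge score sampling is thus squared-norm sampling of the whitened columns, as the covering
bound requires. -/
theorem whiten_col_dotProduct_self (l : Fin n) :
    (whiten B k).col l ⬝ᵥ (whiten B k).col l = ridgeScore B k l := by
  have h1 : (whiten B k).col l = (Matrix.diagonal (fun i => (√(ridgeEigenvalues B k i))⁻¹) *
      (ridgeBasis B k)ᵀ) *ᵥ B.col l := rfl
  have h2 : pinv (ridgeGram_isHermitian B k) = ridgeBasis B k *
      (Matrix.diagonal (fun i => (√(ridgeEigenvalues B k i))⁻¹) *
      Matrix.diagonal (fun i => (√(ridgeEigenvalues B k i))⁻¹)) * (ridgeBasis B k)ᵀ := by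
    rw [← star_ridgeBasis, diagonal_mul_diagonal, pinv]
    congr 3
    funext i
    rw [← mul_inv, Real.mul_self_sqrt (ridgeEigenvalues_nonneg B k i)]
  rw [h1, mulVec_dotProduct, mulVec_mulVec, ridgeScore, h2, transpose_mul, transpose_transpose,
    diagonal_transpose]
  simp only [Matrix.mul_assoc]

theorem whiten_mul_transpose : whiten B k * (whiten B k)ᵀ = Matrix.diagonal
    (fun i => (ridgeEigenvalues B k i - ridgeParam B k) / ridgeEigenvalues B k i) := by
  have h1 : whiten B k * (whiten B k)ᵀ =
      Matrix.diagonal (fun i => (√(ridgeEigenvalues B k i))⁻¹) *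
      ((ridgeBasis B k)ᵀ * (B * Bᵀ) * ridgeBasis B k) *
      Matrix.diagonal (fun i => (√(ridgeEigenvalues B k i))⁻¹) := by
    rw [whiten, transpose_mul, transpose_mul, transpose_transpose, diagonal_transpose]
    simp only [Matrix.mul_assoc]
  rw [h1, gram_eq_spectralMap B k, ridgeBasis_conj, diagonal_mul_diagonal, diagonal_mul_diagonal]
  congr 1
  funext i
  rw [mul_right_comm, ← mul_inv, Real.mul_self_sqrt (ridgeEigenvalues_nonneg B k i),
    inv_mul_eq_div]

theorem sum_ridgeScore : ∑ l, ridgeScore B k l =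
    ∑ i, (ridgeEigenvalues B k i - ridgeParam B k) / ridgeEigenvalues B k i := by
  rw [← Finset.sum_congr rfl fun l _ => whiten_col_dotProduct_self B k l,
    ← norm_sq_eq_sum_dotProduct, norm_sq_eq_trace, whiten_mul_transpose, trace_diagonal]

/-- This covers a singular `B Bᵀ + λ I`. With `E` the projection onto its range, `(1 - E) (B Bᵀ + λ
I) (1 - E)ᵀ = 0` has as trace a sum of nonnegative terms, one of which is `‖(1 - E) B‖²`. -/
theorem ridgeGram_mul_pinv_mul :
    ridgeGram B k * pinv (ridgeGram_isHermitian B k) * B = B := by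
  set E := ridgeGram B k * pinv (ridgeGram_isHermitian B k) with hE
  have h1 : Eᵀ = E := mul_pinv_transpose _
  have h2 : (1 - E) * ridgeGram B k = 0 := by
    rw [Matrix.sub_mul, Matrix.one_mul, hE, mul_pinv_mul, sub_self]
  have h3 : ‖(1 - E) * B‖ ^ 2 + ridgeParam B k * ‖1 - E‖ ^ 2 = 0 := by
    have h4 : (1 - E) * ridgeGram B k * (1 - E)ᵀ =
        (1 - E) * B * ((1 - E) * B)ᵀ + ridgeParam B k • ((1 - E) * (1 - E)ᵀ) := by
      rw [ridgeGram, Matrix.mul_add, Matrix.add_mul, transpose_mul, Matrix.mul_smul,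
        Matrix.mul_one, Matrix.smul_mul]
      simp only [Matrix.mul_assoc]
    rw [norm_sq_eq_trace, norm_sq_eq_trace, ← smul_eq_mul, ← trace_smul, ← trace_add, ← h4, h2,
      Matrix.zero_mul, trace_zero]
  have h5 := mul_nonneg (ridgeParam_nonneg B k) (sq_nonneg ‖1 - E‖)
  have h6 : ‖(1 - E) * B‖ ^ 2 = 0 := le_antisymm (by linarith) (sq_nonneg _)
  rw [sq_eq_zero_iff, norm_eq_zero, Matrix.sub_mul, Matrix.one_mul, sub_eq_zero] at h6
  exact h6.symm

/-- The dual coordinates: `Xᵀ v = Bᵀ y` for `X = whiten B k` and `v = unwhiten B k y`. -/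
noncomputable def unwhiten (y : Fin d → ℝ) : Fin d → ℝ :=
  (Matrix.diagonal (fun i => √(ridgeEigenvalues B k i)) * (ridgeBasis B k)ᵀ) *ᵥ y

theorem whiten_transpose_mulVec_unwhiten (y : Fin d → ℝ) :
    (whiten B k)ᵀ *ᵥ unwhiten B k y = Bᵀ *ᵥ y := by
  have h1 : (whiten B k)ᵀ * (Matrix.diagonal (fun i => √(ridgeEigenvalues B k i)) *
      (ridgeBasis B k)ᵀ) = (ridgeGram B k * pinv (ridgeGram_isHermitian B k) * B)ᵀ := by
    rw [transpose_mul, mul_pinv_transpose, mul_pinv_eq, whiten, transpose_mul, transpose_mul,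
      transpose_transpose, diagonal_transpose]
    change _ = Bᵀ * (ridgeBasis B k * _ * star (ridgeBasis B k))
    rw [star_ridgeBasis]
    have h2 : (fun i => ridgeEigenvalues B k i * (ridgeEigenvalues B k i)⁻¹) =
        fun i => (√(ridgeEigenvalues B k i))⁻¹ * √(ridgeEigenvalues B k i) := by
      funext i
      rcases (ridgeEigenvalues_nonneg B k i).eq_or_lt with h | h
      · rw [← h]; simp
      · rw [mul_inv_cancel₀ h.ne', inv_mul_cancel₀ (Real.sqrt_pos.2 h).ne']
    rw [h2, ← diagonal_mul_diagonal]
    simp only [Matrix.mul_assoc]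
  rw [unwhiten, mulVec_mulVec, h1, ridgeGram_mul_pinv_mul]

theorem unwhiten_dotProduct_self (y : Fin d → ℝ) : unwhiten B k y ⬝ᵥ unwhiten B k y =
    (Bᵀ *ᵥ y) ⬝ᵥ (Bᵀ *ᵥ y) + ridgeParam B k * (y ⬝ᵥ y) := by
  have h1 : (Matrix.diagonal (fun i => √(ridgeEigenvalues B k i)) * (ridgeBasis B k)ᵀ)ᵀ *
      (Matrix.diagonal (fun i => √(ridgeEigenvalues B k i)) * (ridgeBasis B k)ᵀ) =
      ridgeGram B k := by
    have h2 : ridgeGram B k = ridgeBasis B k * Matrix.diagonal (ridgeEigenvalues B k) *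
        (ridgeBasis B k)ᵀ := by
      rw [← star_ridgeBasis]
      exact spectral_eq (ridgeGram_isHermitian B k)
    have h3 : ridgeEigenvalues B k =
        fun i => √(ridgeEigenvalues B k i) * √(ridgeEigenvalues B k i) := by
      funext i
      rw [Real.mul_self_sqrt (ridgeEigenvalues_nonneg B k i)]
    conv_rhs => rw [h2, h3, ← diagonal_mul_diagonal]
    rw [transpose_mul, transpose_transpose, diagonal_transpose]
    simp only [Matrix.mul_assoc]
  rw [unwhiten, mulVec_dotProduct, mulVec_mulVec, h1, ridgeGram, add_mulVec, dotProduct_add,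
    smul_mulVec, one_mulVec, dotProduct_smul, smul_eq_mul, mulVec_dotProduct, mulVec_mulVec,
    transpose_transpose]

variable {k}

/-- The ridge leverage scores add up to at most `2 k`. -/
theorem sum_ridgeScore_le (hk : 0 < k) : ∑ l, ridgeScore B k l ≤ 2 * k := by
  set m := ridgeEigenvalues B k with hm
  set lam := ridgeParam B k with hlam
  have hlam0 : 0 ≤ lam := ridgeParam_nonneg B k
  have hm0 : ∀ i, 0 ≤ m i := ridgeEigenvalues_nonneg B k
  have hml : ∀ i, lam ≤ m i := ridgeParam_le_ridgeEigenvalues B k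
  -- `c` plays the role of `1 / λ`; for `λ = 0` any upper bound of the `1 / m i` will do.
  have hc : ∃ c : ℝ, 0 ≤ c ∧ c * lam ≤ 1 ∧ ∀ i, (m i - lam) / m i ≤ c * (m i - lam) := by
    rcases hlam0.eq_or_lt with h0 | h0
    · refine ⟨∑ i, (m i)⁻¹, Finset.sum_nonneg fun i _ => inv_nonneg.2 (hm0 i), by simp [← h0],
        fun i => ?_⟩
      rw [div_eq_inv_mul]
      exact mul_le_mul_of_nonneg_right (Finset.single_le_sum
        (f := fun i => (m i)⁻¹) (fun i _ => inv_nonneg.2 (hm0 i)) (Finset.mem_univ i))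
        (sub_nonneg.2 (hml i))
    · refine ⟨lam⁻¹, inv_nonneg.2 hlam0, (inv_mul_cancel₀ h0.ne').le, fun i => ?_⟩
      rw [div_eq_inv_mul]
      exact mul_le_mul_of_nonneg_right (inv_anti₀ h0 (hml i)) (sub_nonneg.2 (hml i))
  obtain ⟨c, hc0, hc1, hc2⟩ := hc
  set hM := ridgeGram_isHermitian B k
  set w : Fin d → ℝ := fun i => (m i - lam) / m i with hw
  have hw1 : ∀ i, 0 ≤ 1 - w i := fun i =>
    sub_nonneg.2 (div_le_one_of_le₀ (by linarith) (hm0 i))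
  -- Split the trace along the column space of `C`: inside use `w ≤ 1`, which costs the rank;
  -- outside use `w ≤ c (m - λ)`, which costs `c ‖B - C‖²`.
  have hbound : ∀ C : Matrix (Fin d) (Fin n) ℝ, C.rank ≤ k →
      ∑ i, w i ≤ k + c * ‖B - C‖ ^ 2 := by
    intro C hC
    obtain ⟨P, -, h1, h2, h3, -, h4⟩ := exists_proj C
    obtain ⟨h5, h6⟩ := one_sub_proj h1 h2
    have h7 := trace_proj_mul_nonneg h1 h2 (spectralMap_posSemidef hM hw1)
    rw [← spectralMap_sub, spectralMap_one, Matrix.mul_sub, Matrix.mul_one, trace_sub, h4] at h7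
    have h8 : (c • (B * Bᵀ) - spectralMap hM w).PosSemidef := by
      have e : c • (B * Bᵀ) = spectralMap hM (fun i => c * (m i - lam)) := by
        rw [gram_eq_spectralMap B k, smul_spectralMap]
      rw [e, spectralMap_sub]
      exact spectralMap_posSemidef hM fun i => sub_nonneg.2 (hc2 i)
    have h9 := trace_proj_mul_nonneg h5 h6 h8
    rw [Matrix.mul_sub, trace_sub, Matrix.mul_smul, trace_smul, smul_eq_mul] at h9
    have h10 : ((1 - P) * (B * Bᵀ)).trace ≤ ‖B - C‖ ^ 2 := by
      have e1 : (1 - P) * B = (1 - P) * (B - C) := by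
        rw [Matrix.mul_sub (1 - P), Matrix.sub_mul 1 P C, h3, Matrix.one_mul, sub_self, sub_zero]
      have e2 : ((1 - P) * (B * Bᵀ)).trace = ((1 - P) * ((B - C) * (B - C)ᵀ)).trace := by
        have e3 : ∀ D : Matrix (Fin d) (Fin n) ℝ, ((1 - P) * (D * Dᵀ)).trace =
            (((1 - P) * D) * ((1 - P) * D)ᵀ).trace := by
          intro D
          rw [transpose_mul, h5, ← Matrix.mul_assoc ((1 - P) * D), Matrix.trace_mul_comm _ (1 - P),
            ← Matrix.mul_assoc (1 - P) ((1 - P) * D), ← Matrix.mul_assoc (1 - P) (1 - P), h6,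
            Matrix.mul_assoc]
        rw [e3, e1, ← e3]
      rw [e2, norm_sq_eq_trace]
      refine trace_proj_mul_le h5 h6 ?_
      have := posSemidef_self_mul_conjTranspose (B - C)
      rwa [conjTranspose_eq_transpose_of_trivial] at this
    have h11 : (spectralMap hM w).trace = (P * spectralMap hM w).trace +
        ((1 - P) * spectralMap hM w).trace := by
      rw [Matrix.sub_mul, Matrix.one_mul, trace_sub]; ring
    rw [trace_spectralMap] at h11
    have h12 : (C.rank : ℝ) ≤ k := by exact_mod_cast hC
    have h13 := mul_le_mul_of_nonneg_left h10 hc0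
    linarith
  rw [sum_ridgeScore]
  have hfin : ∑ i, w i ≤ k + c * (k * lam) := by
    refine le_of_forall_pos_le_add fun e he => ?_
    obtain ⟨C, hC, hlt⟩ := exists_norm_sq_lt (B := B) hk (div_pos he (by linarith : 0 < c + 1))
    have h1 := hbound C hC
    have h2 := mul_le_mul_of_nonneg_left hlt.le hc0
    have h3 : c * (e / (c + 1)) ≤ e := by
      rw [mul_div_assoc', div_le_iff₀ (by linarith)]
      nlinarith
    rw [mul_add] at h2
    linarith
  have : c * (k * lam) ≤ k := by
    have := mul_le_mul_of_nonneg_right hc1 (Nat.cast_nonneg (α := ℝ) k)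
    linarith
  change ∑ i, w i ≤ 2 * k
  linarith

end Whitening

/-! ### The approximation guarantee and its sample size. -/

section Approximation

variable {d n k r : ℕ} {A : Matrix (Fin k) (Fin n) ℝ} {B : Matrix (Fin d) (Fin n) ℝ}
  {p : Fin n → ℝ}

theorem mul_samplingMatrix_transpose_col (s : Fin r → Fin n) (t : Fin r) :
    (B * (samplingMatrix p s)ᵀ).col t = (1 / √(r * p (s t))) • B.col (s t) := by
  ext i
  simp [Matrix.mul_apply, samplingMatrix, mul_comm]

theorem col_mul_mem_span {m : ℕ} (G : Matrix (Fin d) (Fin m) ℝ) (N : Matrix (Fin m) (Fin k) ℝ)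
    (j : Fin k) : (G * N).col j ∈ Submodule.span ℝ (Set.range G.col) := by
  rw [← range_mulVecLin]
  exact ⟨N.col j, rfl⟩

/-- If the sample covers the whitened columns of `B`, its span contains a `2`-approximate
solution. -/
theorem exists_approx_of_not_uncovered (hk : 0 < k) (hp : IsRidgeDistribution B k p)
    {s : Fin r → Fin n} (hs : ¬ Uncovered (whiten B k) (1 / 4) 1 s) :
    ∃ X' : Matrix (Fin d) (Fin k) ℝ, X'.rank ≤ k ∧
      (∀ j, X'.col j ∈ Submodule.span ℝ (Set.range (B * (samplingMatrix p s)ᵀ).col)) ∧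
      ‖X' * A - B‖ ^ 2 ≤ 2 * opt A B := by
  obtain ⟨P, N, hP1, hP2, hPN, hPk, hsol⟩ := exists_solution A B
  obtain ⟨Q, N', h1, h2, h3, h4, -⟩ := exists_proj (B * (samplingMatrix p s)ᵀ)
  refine ⟨Q * (B * N), rank_le_width _, fun j => ?_,
    norm_sq_proj_le hk hP1 hP2 hPN hPk hsol h1 h2 fun y hy => ?_⟩
  · rw [h4, Matrix.mul_assoc]
    exact col_mul_mem_span _ _ j
  · have hcol : ∀ l, (whiten B k).col l ⬝ᵥ unwhiten B k y = B.col l ⬝ᵥ y := fun l =>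
      congrFun (whiten_transpose_mulVec_unwhiten B k y) l
    have horth : ∀ t, (whiten B k).col (s t) ⬝ᵥ unwhiten B k y = 0 := by
      intro t
      -- An index of probability zero gives a zero row of the sampling matrix, but its score also
      -- vanishes, so its whitened column is zero.
      by_cases h0 : p (s t) = 0
      · have h5 := hp.2.2 (s t)
        rw [h0, zero_mul, ← whiten_col_dotProduct_self] at h5
        rw [dotProduct_self_eq_zero.1 h5.symm, zero_dotProduct]
      · have hr : 0 < r := t.pos
        have hpos : 0 < √(r * p (s t)) := Real.sqrt_pos.2
          (mul_pos (by exact_mod_cast hr) (lt_of_le_of_ne (hp.1 _) (Ne.symm h0)))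
        have h5 : (B * (samplingMatrix p s)ᵀ)ᵀ *ᵥ y = 0 := by
          rw [← h3, transpose_mul, h1, ← mulVec_mulVec, hy, mulVec_zero]
        have h6 : (B * (samplingMatrix p s)ᵀ).col t ⬝ᵥ y = 0 := congrFun h5 t
        rw [mul_samplingMatrix_transpose_col, smul_dotProduct, smul_eq_mul] at h6
        rw [hcol]
        exact (mul_eq_zero.1 h6).resolve_left (one_div_pos.2 hpos).ne'
    have h7 : ¬ _ := fun hlt => hs ⟨unwhiten B k y, one_mulVec _, horth, hlt⟩
    rw [whiten_transpose_mulVec_unwhiten, unwhiten_dotProduct_self] at h7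
    linarith

theorem measureReal_uncovered_le {Ω : Type*} [MeasurableSpace Ω] {μ : Measure Ω}
    [IsProbabilityMeasure μ] {I : Fin r → Ω → Fin n} (hI : IsIIDSample μ p I) (hk : 0 < k)
    (hp : IsRidgeDistribution B k p) :
    μ.real {ω | Uncovered (whiten B k) (1 / 4) 1 fun t => I t ω} ≤
      8 * k * Real.exp (-(r / (8 * k))) := by
  classical
  set T := ∑ l, ridgeScore B k l with hT
  have hkR : (0 : ℝ) < k := by exact_mod_cast hk
  have hT2 : T ≤ 2 * k := sum_ridgeScore_le B hk
  have hcol : ∀ a, p a * T = (whiten B k).col a ⬝ᵥ (whiten B k).col a := fun a => by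
    rw [hp.2.2, whiten_col_dotProduct_self]
  have htr : (whiten B k * (whiten B k)ᵀ).trace = T := by
    rw [whiten_mul_transpose, trace_diagonal, hT, sum_ridgeScore]
  have hT0 : 0 ≤ T := Finset.sum_nonneg fun l _ => by
    rw [← whiten_col_dotProduct_self]
    exact dotProduct_self_nonneg _
  rcases hT0.eq_or_lt with h0 | h0
  -- If all scores vanish, the whitened matrix is zero and every sample covers it.
  · have hemp : {ω | Uncovered (whiten B k) (1 / 4) 1 fun t => I t ω} = ∅ := by
      refine Set.eq_empty_of_forall_notMem fun ω hω => ?_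
      obtain ⟨v, -, -, hlt⟩ := hω
      have hz : (whiten B k)ᵀ *ᵥ v = 0 := by
        funext l
        have := hcol l
        rw [← h0, mul_zero] at this
        change (whiten B k).col l ⬝ᵥ v = 0
        rw [dotProduct_self_eq_zero.1 this.symm, zero_dotProduct]
      rw [hz, dotProduct_zero] at hlt
      linarith [dotProduct_self_nonneg v]
    rw [hemp, measureReal_empty]
    positivity
  · rw [hI.measureReal_setOf]
    have hW : (whiten B k * (whiten B k)ᵀ).PosSemidef := by
      have := posSemidef_self_mul_conjTranspose (whiten B k)
      rwa [conjTranspose_eq_transpose_of_trivial] at this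
    have hZ : (whiten B k * (whiten B k)ᵀ - (1 * (whiten B k * (whiten B k)ᵀ) * 1 -
        (1 / 4 : ℝ) • (1 : Matrix (Fin d) (Fin d) ℝ))).PosSemidef := by
      rw [Matrix.one_mul, Matrix.mul_one, sub_sub_cancel]
      exact PosSemidef.one.smul (by norm_num)
    refine (sum_uncovered_le hp.1 hp.2.1 h0 hcol (by norm_num : (0 : ℝ) < 1 / 4) r 1 _
      transpose_one (Matrix.mul_one _) hW hZ).trans ?_
    rw [htr, ← Real.exp_nat_mul]
    have h1 : (r : ℝ) * (-(1 / 4) / T) ≤ -(r / (8 * k)) := by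
      have h2 : (r : ℝ) / (8 * k) ≤ r / (4 * T) :=
        div_le_div_of_nonneg_left (Nat.cast_nonneg r) (by positivity) (by linarith)
      have h3 : (r : ℝ) * (-(1 / 4) / T) = -(r / (4 * T)) := by field_simp
      linarith
    calc _ ≤ Real.exp (-(r / (8 * k))) * (2 * k / (1 / 4)) :=
          mul_le_mul (Real.exp_le_exp.2 h1)
            (div_le_div_of_nonneg_right hT2 (by norm_num)) (by positivity) (Real.exp_pos _).le
      _ = _ := by ring

theorem failure_le_of_sample_size {ε δ : ℝ} (hk : 0 < k) (hε : 0 < ε) (hε1 : ε < 1) (hδ : 0 < δ)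
    (hδ1 : δ < 1) (hr : 24 * k * Real.log (2 * k / δ) / ε ^ 2 ≤ r) :
    8 * k * Real.exp (-(r / (8 * k))) ≤ δ := by
  have hk1 : (1 : ℝ) ≤ k := by exact_mod_cast hk
  have hx : 2 ≤ 2 * k / δ := by rw [le_div_iff₀ hδ]; nlinarith
  have hlog : 0 ≤ Real.log (2 * k / δ) := Real.log_nonneg (by linarith)
  have h1 : 24 * k * Real.log (2 * k / δ) ≤ r := by
    refine le_trans ?_ hr
    rw [le_div_iff₀ (by positivity)]
    have : ε ^ 2 ≤ 1 := pow_le_one₀ hε.le hε1.le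
    nlinarith [mul_nonneg (mul_nonneg (by norm_num : (0:ℝ) ≤ 24) (by linarith : (0:ℝ) ≤ k)) hlog]
  have h2 : 3 * Real.log (2 * k / δ) ≤ r / (8 * k) := by
    rw [le_div_iff₀ (by positivity)]
    linarith
  -- With `x = 2 k / δ ≥ 2` this is `4 x ≤ x ^ 3`; together with the `8 k` in the exponent it gives
  -- the constant `24 = 3 * 8`.
  have h3 : Real.log (8 * k / δ) ≤ 3 * Real.log (2 * k / δ) := by
    have e : (3 : ℝ) * Real.log (2 * k / δ) = Real.log ((2 * k / δ) ^ 3) := by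
      rw [Real.log_pow]; norm_num
    rw [e]
    refine Real.log_le_log (by positivity) ?_
    have e2 : 8 * k / δ = 4 * (2 * k / δ) := by ring
    rw [e2]
    nlinarith [mul_nonneg (by linarith : 0 ≤ 2 * k / δ)
      (by nlinarith : 0 ≤ (2 * k / δ) ^ 2 - 4)]
  calc 8 * k * Real.exp (-(r / (8 * k))) ≤ 8 * k * Real.exp (-Real.log (8 * k / δ)) := by
        gcongr
        linarith
    _ = δ := by
        rw [Real.exp_neg, Real.exp_log (by positivity)]
        field_simp

theorem approximation {ε δ : ℝ} (hk : 0 < k) (hε : 0 < ε) (hε1 : ε < 1) (hδ : 0 < δ)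
    (hδ1 : δ < 1) (hr : 24 * k * Real.log (2 * k / δ) / ε ^ 2 ≤ r)
    (hp : IsRidgeDistribution B k p) {Ω : Type*} [MeasurableSpace Ω] (μ : Measure Ω)
    [IsProbabilityMeasure μ] (I : Fin r → Ω → Fin n) (hI : IsIIDSample μ p I) :
    1 - δ ≤ μ.real {ω | ∃ X' : Matrix (Fin d) (Fin k) ℝ, X'.rank ≤ k ∧
      (∀ j, X'.col j ∈ Submodule.span ℝ
        (Set.range (B * (samplingMatrix p (fun t => I t ω))ᵀ).col)) ∧
      ‖X' * A - B‖ ^ 2 ≤ (2 + ε) * opt A B} := by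
  have hopt : 0 ≤ opt A B := Real.sInf_nonneg (by rintro c ⟨X, -, rfl⟩; positivity)
  have h1 := (measureReal_uncovered_le hI hk hp).trans
    (failure_le_of_sample_size hk hε hε1 hδ hδ1 hr)
  have h2 := probReal_compl_eq_one_sub (μ := μ)
    (hI.measurableSet fun s => Uncovered (whiten B k) (1 / 4) 1 s)
  refine le_trans (b := μ.real {ω | Uncovered (whiten B k) (1 / 4) 1 fun t => I t ω}ᶜ)
    (by linarith) (measureReal_mono fun ω hω => ?_)
  obtain ⟨X', hX1, hX2, hX3⟩ := exists_approx_of_not_uncovered (A := A) hk hp hω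
  exact ⟨X', hX1, hX2, hX3.trans (mul_le_mul_of_nonneg_right (by linarith) hopt)⟩

end Approximation

/-! ### The hard instances -/

section Hard

variable {n r : ℕ}

theorem solutions_eq_singleton {A B : Matrix (Fin 1) (Fin n) ℝ} {c x e : ℝ} (hc : 0 < c)
    (h : ∀ Y : Matrix (Fin 1) (Fin 1) ℝ, ‖Y * A - B‖ ^ 2 = c * (Y 0 0 - x) ^ 2 + e) :
    solutions A B = {x • (1 : Matrix (Fin 1) (Fin 1) ℝ)} := by
  ext X
  rw [Set.mem_singleton_iff]
  constructor
  · rintro ⟨-, hX⟩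
    have h1 := hX (x • 1) (rank_le_width _)
    rw [h, h] at h1
    simp only [Matrix.smul_apply, Matrix.one_apply_eq, smul_eq_mul, mul_one, sub_self] at h1
    have h2 : (X 0 0 - x) ^ 2 ≤ 0 := by
      by_contra hcon
      have := mul_pos hc (not_le.1 hcon)
      linarith
    have h3 : X 0 0 = x := by nlinarith [sq_nonneg (X 0 0 - x)]
    ext i j
    rw [Subsingleton.elim i 0, Subsingleton.elim j 0]
    simp [h3]
  · rintro rfl
    refine ⟨rank_le_width _, fun Y _ => ?_⟩
    rw [h, h]
    have := mul_nonneg hc.le (sq_nonneg (Y 0 0 - x))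
    simp
    exact this

theorem cost_eq_sum (A B : Matrix (Fin 1) (Fin n) ℝ) (Y : Matrix (Fin 1) (Fin 1) ℝ) :
    ‖Y * A - B‖ ^ 2 = ∑ l, (Y 0 0 * A 0 l - B 0 l) ^ 2 := by
  rw [norm_sq_eq_sum]
  simp [Matrix.mul_apply]

theorem hard_cost (i : Fin n) (Y : Matrix (Fin 1) (Fin 1) ℝ) :
    ‖Y * hardA i - hardB n‖ ^ 2 = 2 * (Y 0 0 - 1 / 2) ^ 2 + 1 / 2 := by
  have h1 : ∀ l : Fin n, (Y 0 0 * hardA i 0 l.castSucc - hardB n 0 l.castSucc) ^ 2 =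
      if l = i then Y 0 0 ^ 2 else 0 := by
    intro l
    by_cases h : l = i
    · simp [hardA, hardB, Pi.single_apply, h, (Fin.castSucc_lt_last i).ne]
    · simp [hardA, hardB, Pi.single_apply, h, (Fin.castSucc_lt_last l).ne]
  have h2 : (Y 0 0 * hardA i 0 (Fin.last n) - hardB n 0 (Fin.last n)) ^ 2 = (Y 0 0 - 1) ^ 2 := by
    simp [hardA, hardB, Pi.single_apply, (Fin.castSucc_lt_last i).ne']
  rw [cost_eq_sum, Fin.sum_univ_castSucc, h2, Finset.sum_congr rfl fun l _ => h1 l,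
    Finset.sum_ite_eq' Finset.univ i]
  simp
  ring

theorem solutions_hard (i : Fin n) :
    solutions (hardA i) (hardB n) = {(1 / 2 : ℝ) • (1 : Matrix (Fin 1) (Fin 1) ℝ)} :=
  solutions_eq_singleton two_pos (hard_cost i)

theorem opt_hard (i : Fin n) : opt (hardA i) (hardB n) = 1 / 2 := by
  rw [opt_eq_of_mem_solutions (X := (1 / 2 : ℝ) • 1) (by rw [solutions_hard]; rfl), hard_cost]
  simp

/-- The sampled regression has the unique solution `1` if the last column is sampled and the
`i`-th is not. -/
theorem solutions_sampled {p : Fin (n + 1) → ℝ} (hp : 0 < p (Fin.last n)) {i : Fin n}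
    {s : Fin r → Fin (n + 1)} (hl : ∃ t, s t = Fin.last n) (hi : ∀ t, s t ≠ i.castSucc) :
    solutions (hardA i * (samplingMatrix p s)ᵀ) (hardB n * (samplingMatrix p s)ᵀ) =
      {(1 : Matrix (Fin 1) (Fin 1) ℝ)} := by
  obtain ⟨t₀, ht₀⟩ := hl
  have hr : (0 : ℝ) < r := by exact_mod_cast t₀.pos
  rw [← one_smul ℝ (1 : Matrix (Fin 1) (Fin 1) ℝ)]
  refine solutions_eq_singleton (e := 0)
    (c := ∑ t, if s t = Fin.last n then (1 / √(r * p (s t))) ^ 2 else 0) ?_ fun Y => ?_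
  · refine Finset.sum_pos' (fun t _ => by split_ifs <;> positivity) ⟨t₀, Finset.mem_univ _, ?_⟩
    rw [if_pos ht₀, ht₀]
    have : 0 < √(r * p (Fin.last n)) := Real.sqrt_pos.2 (mul_pos hr hp)
    positivity
  · have hcol : ∀ (M : Matrix (Fin 1) (Fin (n + 1)) ℝ) t,
        (M * (samplingMatrix p s)ᵀ) 0 t = 1 / √(r * p (s t)) * M 0 (s t) := fun M t =>
      congrFun (mul_samplingMatrix_transpose_col (B := M) s t) 0
    rw [cost_eq_sum, add_zero, Finset.sum_mul]
    refine Finset.sum_congr rfl fun t _ => ?_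
    rw [hcol, hcol]
    have hA : hardA i 0 (s t) = if s t = Fin.last n then 1 else 0 := by
      simp [hardA, Pi.single_apply, hi t]
    have hB : hardB n 0 (s t) = if s t = Fin.last n then 1 else 0 := by
      simp [hardB, Pi.single_apply]
    rw [hA, hB]
    split_ifs <;> ring

theorem ridgeDistribution_hard {p : Fin (n + 1) → ℝ} (hp : IsRidgeDistribution (hardB n) 1 p) :
    p (Fin.last n) = 1 := by
  have h0 : ∀ j : Fin n, ridgeScore (hardB n) 1 j.castSucc = 0 := by
    intro j
    have : (hardB n).col j.castSucc = 0 := by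
      ext a
      simp [hardB, Pi.single_apply, (Fin.castSucc_lt_last j).ne]
    rw [ridgeScore, this, zero_dotProduct]
  have h1 : ridgeScore (hardB n) 1 (Fin.last n) ≠ 0 := by
    have hM := mul_pinv_mul (ridgeGram_isHermitian (hardB n) 1)
    have hM0 : ridgeGram (hardB n) 1 0 0 = 1 + ridgeParam (hardB n) 1 := by
      simp [ridgeGram, hardB, Matrix.mul_apply, Pi.single_apply]
    have hpos := ridgeParam_nonneg (hardB n) 1
    have hs : ridgeScore (hardB n) 1 (Fin.last n) =
        pinv (ridgeGram_isHermitian (hardB n) 1) 0 0 := by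
      simp [ridgeScore, dotProduct, mulVec, hardB]
    -- For the `1 × 1` matrix `M = 1 + λ > 0`, the equation `M M† M = M` rules out `M† = 0`.
    have h2 := congrFun (congrFun hM 0) 0
    rw [Matrix.mul_apply, Fin.sum_univ_one, Matrix.mul_apply, Fin.sum_univ_one, ← hs, hM0] at h2
    intro h3
    rw [h3] at h2
    linarith
  have h2 := hp.2.2 (Fin.last n)
  rw [Fin.sum_univ_castSucc, Finset.sum_eq_zero fun j _ => h0 j, zero_add] at h2
  exact mul_right_cancel₀ h1 (h2.trans (one_mul _).symm)

variable {Ω : Type*} [MeasurableSpace Ω] {μ : Measure Ω} [IsProbabilityMeasure μ]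
  {p : Fin (n + 1) → ℝ} {I : Fin r → Ω → Fin (n + 1)}

theorem ae_solutions_sampled (hr : 0 < r) (hp : IsRidgeDistribution (hardB n) 1 p)
    (hI : IsIIDSample μ p I) (i : Fin n) :
    ∀ᵐ ω ∂μ, solutions (hardA i * (samplingMatrix p (fun t => I t ω))ᵀ)
      (hardB n * (samplingMatrix p (fun t => I t ω))ᵀ) = {(1 : Matrix (Fin 1) (Fin 1) ℝ)} := by
  have hlast := ridgeDistribution_hard hp
  have h : ∀ᵐ ω ∂μ, ∀ t, I t ω = Fin.last n := by
    refine ae_all_iff.2 fun t => ?_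
    have h1 : μ.real {ω | I t ω = Fin.last n} = 1 := (hI.law t _).trans hlast
    have hmeas : MeasurableSet {ω | I t ω = Fin.last n} :=
      hI.measurableSet fun s => s t = Fin.last n
    have h2 := probReal_compl_eq_one_sub (μ := μ) hmeas
    rw [h1, sub_self, measureReal_eq_zero_iff] at h2
    exact h2
  filter_upwards [h] with ω hω
  refine solutions_sampled (by rw [hlast]; exact one_pos) ⟨⟨0, hr⟩, hω _⟩ fun t => ?_
  rw [hω t]
  exact (Fin.castSucc_lt_last i).ne'

theorem le_measureReal_solutions_sampled (hp : 0 < p (Fin.last n)) (hI : IsIIDSample μ p I)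
    (i : Fin n) :
    1 - (1 - p (Fin.last n)) ^ r - r * p i.castSucc ≤
      μ.real {ω | solutions (hardA i * (samplingMatrix p (fun t => I t ω))ᵀ)
        (hardB n * (samplingMatrix p (fun t => I t ω))ᵀ) =
          {(1 : Matrix (Fin 1) (Fin 1) ℝ)}} := by
  have h1 : μ.real (⋂ t, I t ⁻¹' {Fin.last n}ᶜ) = (1 - p (Fin.last n)) ^ r := by
    have h2 : ∀ t, μ.real (I t ⁻¹' {Fin.last n}ᶜ) = 1 - p (Fin.last n) := by
      intro t
      rw [Set.preimage_compl,
        probReal_compl_eq_one_sub (hI.measurable t (measurableSet_singleton _))]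
      exact congrArg _ (hI.law t _)
    rw [hI.measureReal_inter, Finset.prod_congr rfl fun t _ => h2 t]
    simp
  have h2 : μ.real (⋃ t, {ω | I t ω = i.castSucc}) ≤ r * p i.castSucc := by
    refine (measureReal_iUnion_fintype_le _).trans ?_
    rw [Finset.sum_congr rfl fun t _ => hI.law t i.castSucc]
    simp
  set D := (⋂ t, I t ⁻¹' {Fin.last n}ᶜ) ∪ ⋃ t, {ω | I t ω = i.castSucc} with hD
  have hDm : MeasurableSet D := by
    refine MeasurableSet.union (MeasurableSet.iInter fun t => ?_) (MeasurableSet.iUnion fun t => ?_)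
    · exact hI.measurable t (Set.toFinite _).measurableSet
    · exact hI.measurable t (measurableSet_singleton i.castSucc)
  have h3 : μ.real D ≤ _ := measureReal_union_le _ _
  have h4 := probReal_compl_eq_one_sub (μ := μ) hDm
  refine le_trans (b := μ.real Dᶜ) (by linarith) (measureReal_mono fun ω hω => ?_)
  simp only [hD, Set.mem_compl_iff, Set.mem_union, Set.mem_iInter, Set.mem_iUnion,
    Set.mem_preimage, Set.mem_singleton_iff, Set.mem_ofPred_eq, not_or, not_forall,
    not_exists, not_not] at hω
  exact solutions_sampled hp hω.1 hω.2

theorem le_average_measureReal_solutions_sampled (hn : 0 < n) (hI : IsIIDSample μ p I) :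
    1 - (1 - p (Fin.last n)) ^ r - r * (1 - p (Fin.last n)) / n ≤
      (∑ i : Fin n, μ.real {ω | solutions (hardA i * (samplingMatrix p (fun t => I t ω))ᵀ)
        (hardB n * (samplingMatrix p (fun t => I t ω))ᵀ) =
          {(1 : Matrix (Fin 1) (Fin 1) ℝ)}}) / n := by
  have hnR : (0 : ℝ) < n := by exact_mod_cast hn
  have hnonneg : 0 ≤ (∑ i : Fin n, μ.real {ω |
      solutions (hardA i * (samplingMatrix p (fun t => I t ω))ᵀ)
        (hardB n * (samplingMatrix p (fun t => I t ω))ᵀ) =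
          {(1 : Matrix (Fin 1) (Fin 1) ℝ)}}) / n :=
    div_nonneg (Finset.sum_nonneg fun i _ => measureReal_nonneg) hnR.le
  -- Only a drawn index forces `p` to sum to `1`; for `r = 0` the lower bound is `0`.
  rcases Nat.eq_zero_or_pos r with rfl | hr
  · simpa using hnonneg
  have hsum : ∑ l, p l = 1 := by
    rw [← Finset.sum_congr rfl fun l _ => hI.law ⟨0, hr⟩ l]
    have h := sum_measureReal_preimage_singleton (μ := μ) (f := I ⟨0, hr⟩) Finset.univ
      (fun l _ => hI.measurable _ (measurableSet_singleton l))
    rw [Finset.coe_univ, Set.preimage_univ, probReal_univ] at h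
    exact h
  have hlast : 0 ≤ p (Fin.last n) := by
    rw [← hI.law ⟨0, hr⟩]
    exact measureReal_nonneg
  rcases hlast.eq_or_lt with h0 | h0
  · refine le_trans ?_ hnonneg
    rw [← h0, sub_zero, one_pow, sub_self, zero_sub, mul_one, neg_nonpos]
    positivity
  · rw [le_div_iff₀ hnR]
    refine le_trans (le_of_eq ?_)
      (Finset.sum_le_sum fun i _ => le_measureReal_solutions_sampled h0 hI i)
    have h1 : ∑ i : Fin n, p i.castSucc = 1 - p (Fin.last n) := by
      rw [Fin.sum_univ_castSucc] at hsum
      linarith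
    rw [Finset.sum_sub_distrib, ← Finset.mul_sum, h1]
    simp
    field_simp

end Hard

end RidgeSampling

theorem mainTheorem8 :
    -- the approximation guarantee
    (∃ C : ℝ, 0 < C ∧
      ∀ (k d n r : ℕ) (A : Matrix (Fin k) (Fin n) ℝ) (B : Matrix (Fin d) (Fin n) ℝ) (ε δ : ℝ),
        0 < k → 0 < ε → ε < 1 → 0 < δ → δ < 1 →
        C * k * Real.log (2 * k / δ) / ε ^ 2 ≤ r →
        (RidgeSampling.solutions A B).Nonempty ∧
        ∀ p : Fin n → ℝ, RidgeSampling.IsRidgeDistribution B k p →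
        ∀ (Ω : Type*) [MeasurableSpace Ω] (μ : Measure Ω) [IsProbabilityMeasure μ]
          (I : Fin r → Ω → Fin n), RidgeSampling.IsIIDSample μ p I →
          1 - δ ≤ μ.real {ω | ∃ X' : Matrix (Fin d) (Fin k) ℝ, X'.rank ≤ k ∧
            (∀ j, X'.col j ∈ Submodule.span ℝ
              (Set.range (B * (RidgeSampling.samplingMatrix p (fun t => I t ω))ᵀ).col)) ∧
            ‖X' * A - B‖ ^ 2 ≤ (2 + ε) * RidgeSampling.opt A B}) ∧
    -- the instances on which solving the sampled regression loses exactly the factor `2`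
    (∀ (n : ℕ) (i : Fin n),
      RidgeSampling.opt (RidgeSampling.hardA i) (RidgeSampling.hardB n) = 1 / 2 ∧
      RidgeSampling.solutions (RidgeSampling.hardA i) (RidgeSampling.hardB n) =
        {(1 / 2 : ℝ) • (1 : Matrix (Fin 1) (Fin 1) ℝ)} ∧
      ‖(1 : Matrix (Fin 1) (Fin 1) ℝ) * RidgeSampling.hardA i - RidgeSampling.hardB n‖ ^ 2 =
        2 * RidgeSampling.opt (RidgeSampling.hardA i) (RidgeSampling.hardB n)) ∧
    -- ridge leverage score sampling of `e_{n+1}ᵀ`: the sampled solution is almost surely `1`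
    (∀ (n : ℕ) (i : Fin n) (r : ℕ), 0 < r →
      ∀ p : Fin (n + 1) → ℝ, RidgeSampling.IsRidgeDistribution (RidgeSampling.hardB n) 1 p →
      ∀ (Ω : Type*) [MeasurableSpace Ω] (μ : Measure Ω) [IsProbabilityMeasure μ]
        (I : Fin r → Ω → Fin (n + 1)), RidgeSampling.IsIIDSample μ p I →
        ∀ᵐ ω ∂μ, RidgeSampling.solutions
          (RidgeSampling.hardA i * (RidgeSampling.samplingMatrix p (fun t => I t ω))ᵀ)
          (RidgeSampling.hardB n * (RidgeSampling.samplingMatrix p (fun t => I t ω))ᵀ) =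
          {(1 : Matrix (Fin 1) (Fin 1) ℝ)}) ∧
    -- any sampling law `p` that does not depend on the uniformly random index `i`
    (∀ n r : ℕ, 0 < n → ∀ p : Fin (n + 1) → ℝ,
      ∀ (Ω : Type*) [MeasurableSpace Ω] (μ : Measure Ω) [IsProbabilityMeasure μ]
        (I : Fin r → Ω → Fin (n + 1)), RidgeSampling.IsIIDSample μ p I →
        1 - (1 - p (Fin.last n)) ^ r - r * (1 - p (Fin.last n)) / n ≤
          (∑ i : Fin n, μ.real {ω | RidgeSampling.solutions
            (RidgeSampling.hardA i * (RidgeSampling.samplingMatrix p (fun t => I t ω))ᵀ)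
            (RidgeSampling.hardB n * (RidgeSampling.samplingMatrix p (fun t => I t ω))ᵀ) =
            {(1 : Matrix (Fin 1) (Fin 1) ℝ)}}) / n) := by
  refine ⟨⟨24, by norm_num, fun k d n r A B ε δ hk hε hε1 hδ hδ1 hr => ⟨?_, ?_⟩⟩,
    fun n i => ⟨RidgeSampling.opt_hard i, RidgeSampling.solutions_hard i, ?_⟩,
    fun n i r hr p hp Ω _ μ _ I hI => RidgeSampling.ae_solutions_sampled hr hp hI i,
    fun n r hn p Ω _ μ _ I hI => RidgeSampling.le_average_measureReal_solutions_sampled hn hI⟩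
  · obtain ⟨P, N, -, -, -, -, h⟩ := RidgeSampling.exists_solution A B
    exact ⟨_, h⟩
  · intro p hp Ω _ μ _ I hI
    exact RidgeSampling.approximation hk hε hε1 hδ hδ1 hr hp μ I hI
  · rw [RidgeSampling.hard_cost, RidgeSampling.opt_hard]
    norm_num
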